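/- **Model.** Consider $N\ge 1$ robots with headings $\theta_i(t)$ on the circle $\mathbb{R}/2\pi\mathbb{Z}$, and a directed communication graph on the robots; an edge $j\to i$ ($j\neq i$) means that robot $i$ receives the pulses of robot $j$. Fix $\omega_0>0$, $\omega_{\max}>0$, a coupling strength $\alpha\in(0,1]$ and a refractory period $D\in[0,2\pi)$. Each robot carries a phase variable $\phi_i\in[0,2\pi)$ with $\phi_i(0)=\theta_i(0)\in[0,2\pi)$, which initially evolves at the rate $\omega_0$, and its heading is controlled by $\dot\theta_i=\dot\phi_i-\omega_0$. Whenever $\phi_i$ reaches $2\pi$, robot $i$ fires a pulse and $\phi_i$ is reset to $0$. When robot $i$ receives one or more pulses at some instant and $\phi_i\ge D$ (where $\phi_i=0$ if robot $i$ fires at that same instant), it computes $\psi_i=\alpha Q(\phi_i)$, where $$Q(\phi)=\begin{cases}-\phi, & 0\le\phi\le\pi,\\ 2\pi-\phi, & \pi<\phi<2\pi,\end{cases}$$ and from then on its phase evolves at the rate $\dot\phi_i=\omega_0+\operatorname{sgn}(\psi_i)\,\omega_{\max}$ for the time $\tau_i=|\psi_i|/\omega_{\max}$ and at the rate $\dot\phi_i=\omega_0$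 afterwards, until the next pulse to which the robot responds (such a pulse replaces any unfinished adjustment by a newly computed one). Pulses received while $\phi_i\in[0,D)$ are ignored and have no effect on the robot. The containing arc of the headings is the smallest arc of the circle containing all of them; its length is denoted by $\Lambda$. **Theorem.** Suppose that the communication graph is strongly connected, that the containing arc of the initial headings has length less than some $\bar\Lambda\in(0,\pi]$, and that $0\le D\le 2\pi-\bar\Lambda$. Then the evolution is defined for all $t\ge 0$ (firing instances do not accumulate), the heading rate constraint holds (the accumulated heading of each robot is Lipschitz in $t$ with constant $\omega_{\max}$, i.e. $|\dot\theta_i|\le\omega_{\max}$), and the headings synchronize: $\Lambda(t)\to 0$ as $t\to\infty$, and all $\theta_i(t)$ converge to one common heading. -/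

import Mathlib

open Filter Topology

noncomputable section

namespace HeadingSync

/-- The state of one robot: phase variable `φ ∈ [0, 2π)`, accumulated heading `θ` (the heading on the
circle is `θ mod 2π`), the frequency `ω` (field `freq`) chosen at the last pulse that the robot responded to, and
the time `τ` (field `timer`) during which the phase is still to evolve at the frequency `ω`; once `τ` has run out,
the phase evolves at the fundamental frequency. -/
structure RobotState where
  phase : ℝ
  heading : ℝ
  freq : ℝ
  timer : ℝ

/-- Pulse-free evolution during a time `s`: the phase runs at the rate `freq` for the remaining time
`timer` and at the rate `ω₀` afterwards; the heading follows the control `θ' = φ' - ω₀`. -/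
def RobotState.flow (ω₀ s : ℝ) (x : RobotState) : RobotState where
  phase := x.phase + x.freq * min s x.timer + ω₀ * (s - min s x.timer)
  heading := x.heading + (x.freq - ω₀) * min s x.timer
  freq := x.freq
  timer := x.timer - min s x.timer

/-- The delay-advance phase response curve `Q` on `[0, 2π)`. -/
def delayAdvance (φ : ℝ) : ℝ :=
  if φ ≤ Real.pi then -φ else 2 * Real.pi - φ

/-- Reaching the threshold `2π` resets the phase to `0`. -/
def RobotState.reset (x : RobotState) : RobotState :=
  { x with phase := if 2 * Real.pi ≤ x.phase then 0 else x.phase }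

/-- Response to a received pulse. In the refractory region `[0, D)` the pulse is ignored. Otherwise
the adjustment `ψ = α Q(φ)` is determined from the current phase, replacing any unfinished one,
and is carried out at the frequency `ω₀ ± ωmax` (`±` the sign of `ψ`) for the time `|ψ| / ωmax`. -/
def RobotState.respond (ω₀ ωmax α D : ℝ) (x : RobotState) : RobotState :=
  if x.phase < D then x
  else
    { x with
      freq := ω₀ + (SignType.sign (α * delayAdvance x.phase) : ℝ) * ωmax
      timer := |α * delayAdvance x.phase| / ωmax }

variable {N : ℕ}

/-- Initially the phase of each robot is its heading, and all phases run at the rate `ω₀`. -/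
def initialState (ω₀ : ℝ) (θ₀ : Fin N → ℝ) : Fin N → RobotState := fun i =>
  { phase := θ₀ i, heading := θ₀ i, freq := ω₀, timer := 0 }

/-- The waiting time until the next firing: the first time at which some phase reaches `2π`. -/
def waitingTime (ω₀ : ℝ) (x : Fin N → RobotState) : ℝ :=
  sInf {s : ℝ | 0 ≤ s ∧ ∃ i, 2 * Real.pi ≤ ((x i).flow ω₀ s).phase}

open Classical in
/-- A firing instance: the robots whose phase has reached `2π` fire and reset their phase to `0`, and
every robot with a firing in-neighbour (`G.Adj j i`: robot `i` receives the pulses of robot `j`)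
responds. Robots do not receive their own pulses. -/
def firing (G : Digraph (Fin N)) (ω₀ ωmax α D : ℝ) (x : Fin N → RobotState) :
    Fin N → RobotState := fun i =>
  if ∃ j, j ≠ i ∧ G.Adj j i ∧ 2 * Real.pi ≤ (x j).phase then
    (x i).reset.respond ω₀ ωmax α D
  else (x i).reset

/-- The state of the network just after the `n`-th firing instance (initially, for `n = 0`). -/
def eventState (G : Digraph (Fin N)) (ω₀ ωmax α D : ℝ) (θ₀ : Fin N → ℝ) :
    ℕ → Fin N → RobotState
  | 0 => initialState ω₀ θ₀
  | n + 1 =>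
    firing G ω₀ ωmax α D fun i =>
      (eventState G ω₀ ωmax α D θ₀ n i).flow ω₀ (waitingTime ω₀ (eventState G ω₀ ωmax α D θ₀ n))

/-- The time of the `n`-th firing instance (`0` for `n = 0`). -/
def eventTime (G : Digraph (Fin N)) (ω₀ ωmax α D : ℝ) (θ₀ : Fin N → ℝ) (n : ℕ) : ℝ :=
  ∑ k ∈ Finset.range n, waitingTime ω₀ (eventState G ω₀ ωmax α D θ₀ k)

/-- The number of firing instances in `(0, t]`. -/
def eventCount (G : Digraph (Fin N)) (ω₀ ωmax α D : ℝ) (θ₀ : Fin N → ℝ) (t : ℝ) : ℕ :=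
  sSup {n : ℕ | eventTime G ω₀ ωmax α D θ₀ n ≤ t}

/-- The state of the network at time `t ≥ 0`: the state just after the last firing instance up to
time `t`, evolved freely since then. -/
def stateAt (G : Digraph (Fin N)) (ω₀ ωmax α D : ℝ) (θ₀ : Fin N → ℝ) (t : ℝ) :
    Fin N → RobotState := fun i =>
  (eventState G ω₀ ωmax α D θ₀ (eventCount G ω₀ ωmax α D θ₀ t) i).flow ω₀
    (t - eventTime G ω₀ ωmax α D θ₀ (eventCount G ω₀ ωmax α D θ₀ t))

/-- The accumulated heading of robot `i` at time `t`. -/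
def heading (G : Digraph (Fin N)) (ω₀ ωmax α D : ℝ) (θ₀ : Fin N → ℝ) (i : Fin N) (t : ℝ) : ℝ :=
  (stateAt G ω₀ ωmax α D θ₀ t i).heading

/-- The length `Λ` of the smallest arc of the circle that contains all the given headings. -/
def containingArc (θ : Fin N → Real.Angle) : ℝ :=
  sInf {l : ℝ | 0 ≤ l ∧ ∃ a : ℝ, ∀ i, ∃ x ∈ Set.Icc a (a + l), (x : Real.Angle) = θ i}

/-- Every robot can be reached from every other one along directed edges. -/
def StronglyConnected (G : Digraph (Fin N)) : Prop :=
  ∀ i j, Relation.ReflTransGen G.Adj i j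

end HeadingSync

end

/-!
Lift the headings to the real line so that they lie in an interval shorter than `π`. The phase of a
robot is then its lifted heading plus `ω₀ t` modulo `2π`, so that at a pulse of robot `j` the phase
response `Q` of robot `i` is the signed distance from `i` to `j`, and the target heading of `i`
becomes the convex combination `x i + α (x j - x i)`. Headings move toward their targets, hence the
interval spanned by all headings and targets is nested (`PulseRun.Bound.mono`). Every robot
therefore fires once per cycle, and robots ahead fire first; since headings are bounded, firing
instances cannot accumulate (`PulseRun.tendsto_T`).

That the length of this interval tends to zero follows from a contraction over a bounded number of
cycles (`PulseRun.contraction`). Let `m` and `M` be its ends. A robot that lags behind a firing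
in-neighbour has its phase above `2π - Λbar ≥ D`, so it always responds and advances until it fires;
hence a robot firing at a definite distance above `m` forces all robots to fire in the same cycle at a
definite distance above `m`, by strong connectivity (`PulseRun.propagate`). If all robots fire above
some `β` in one cycle, then one of them does so in the next cycle, or the whole interval has dropped
below `β` (`PulseRun.persist`). Therefore one of three things happens: all robots fire below the
midpoint over a long window of cycles, or the interval drops below its midpoint, or all robots fire
at a definite distance above `m` over a long window. A window is long enough for all earlier
adjustments to have run out or been replaced, so that in the first and the third case the
interval shrinks at one end (`PulseRun.Bound.window`).
-/

namespace HeadingSync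

/-! ### Runs sampled at the firing instances -/

/-- A run of the network sampled just after its firing instances, in lifted coordinates, with the
properties of the dynamics on which synchronization depends. Robot `i` fires at the firing instance
`n + 1` if its cycle number increases there. -/
structure PulseRun {N : ℕ} (G : Digraph (Fin N)) (ω₀ ωmax α : ℝ) where
  /-- time of the firing instance -/
  T : ℕ → ℝ
  /-- headings, lifted from the circle to an interval of the real line shorter than `π` -/
  x : ℕ → Fin N → ℝ
  /-- target headings, at which the headings come to rest if no further pulse interferes -/
  g : ℕ → Fin N → ℝ
  /-- number of the current cycle: the phase is `x + ω₀ T - 2π k` -/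
  k : ℕ → Fin N → ℤ
  /-- firing instances are distinct -/
  T_lt : ∀ n, T n < T (n + 1)
  spread : ∃ A l : ℝ, l < Real.pi ∧
    ∀ n i, x n i ∈ Set.Icc A (A + l) ∧ g n i ∈ Set.Icc A (A + l)
  /-- headings move toward their targets at the speed `ωmax` and stop there: lower bound -/
  move_lower : ∀ n i, min (x n i + ωmax * (T (n + 1) - T n)) (g n i) ≤ x (n + 1) i
  /-- headings move toward their targets at the speed `ωmax` and stop there: upper bound -/
  move_upper : ∀ n i, x (n + 1) i ≤ max (x n i - ωmax * (T (n + 1) - T n)) (g n i)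
  phase_nonneg : ∀ n i, 2 * Real.pi * k n i ≤ x n i + ω₀ * T n
  phase_lt : ∀ n i, x n i + ω₀ * T n < 2 * Real.pi * (k n i + 1)
  k_step : ∀ n i, k (n + 1) i = k n i ∨
    (k (n + 1) i = k n i + 1 ∧ x (n + 1) i + ω₀ * T (n + 1) = 2 * Real.pi * k (n + 1) i)
  exists_fires : ∀ n, ∃ i, k (n + 1) i = k n i + 1
  /-- a robot that responds to a pulse of `j` aims at a convex combination with the heading of `j` -/
  target_step : ∀ n i, g (n + 1) i = g n i ∨ ∃ j, k (n + 1) j = k n j + 1 ∧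
    g (n + 1) i = x (n + 1) i + α * (x (n + 1) j - x (n + 1) i)
  /-- a robot that lags behind a firing in-neighbour is not refractory -/
  target_of_lag : ∀ n i j, G.Adj j i → k (n + 1) j = k n j + 1 → x (n + 1) i < x (n + 1) j →
    g (n + 1) i = x (n + 1) i + α * (x (n + 1) j - x (n + 1) i)

namespace PulseRun

variable {N : ℕ} {G : Digraph (Fin N)} {ω₀ ωmax α : ℝ} (R : PulseRun G ω₀ ωmax α)

/-- Robot `i` enters cycle `q` by firing at the firing instance `n + 1`. -/
def FiresIn (q : ℤ) (i : Fin N) (n : ℕ) : Prop := R.k n i + 1 = q ∧ R.k (n + 1) i = q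

/-- All headings and all targets at the firing instance `n` are at least `b` (for `σ = 1`), or at
most `-b` (for `σ = -1`). -/
def Bound (σ : ℝ) (n : ℕ) (b : ℝ) : Prop := ∀ i, b ≤ σ * R.x n i ∧ b ≤ σ * R.g n i

lemma monotone_T : Monotone R.T := monotone_nat_of_le_succ fun n => (R.T_lt n).le

lemma monotone_k (i : Fin N) : Monotone fun n => R.k n i :=
  monotone_nat_of_le_succ fun n => by
    change R.k n i ≤ R.k (n + 1) i
    rcases R.k_step n i with h | h <;> omega

lemma x_sub_x_lt (n : ℕ) (i j : Fin N) : R.x n i - R.x n j < Real.pi := by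
  obtain ⟨A, l, hl, h⟩ := R.spread
  linarith [(h n i).1.2, (h n j).1.1]

lemma abs_x_sub_lt (n p : ℕ) (i : Fin N) : |R.x n i - R.x p i| < Real.pi := by
  obtain ⟨A, l, hl, h⟩ := R.spread
  rw [abs_lt]
  constructor <;> linarith [(h n i).1.2, (h n i).1.1, (h p i).1.2, (h p i).1.1]

lemma abs_g_sub_x_lt (n : ℕ) (i : Fin N) : |R.g n i - R.x n i| < Real.pi := by
  obtain ⟨A, l, hl, h⟩ := R.spread
  rw [abs_lt]
  constructor <;> linarith [(h n i).1.2, (h n i).1.1, (h n i).2.2, (h n i).2.1]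

variable {R} in
lemma FiresIn.front {q : ℤ} {i : Fin N} {n : ℕ} (h : R.FiresIn q i n) :
    R.x (n + 1) i + ω₀ * R.T (n + 1) = 2 * Real.pi * q := by
  obtain ⟨h1, h2⟩ := h
  rcases R.k_step n i with h | h
  · omega
  · rw [h.2, h2]

lemma firesIn_of_fires {i : Fin N} {n : ℕ} (h : R.k (n + 1) i = R.k n i + 1) :
    R.FiresIn (R.k (n + 1) i) i n := ⟨h.symm, rfl⟩

/-- The cycle numbers of two robots differ by at most one. -/
lemma k_le_k_add_one (n : ℕ) (i j : Fin N) : R.k n i ≤ R.k n j + 1 := by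
  have h1 := R.phase_nonneg n i
  have h2 := R.phase_lt n j
  have h3 := R.x_sub_x_lt n i j
  have hπ := Real.pi_pos
  by_contra! h
  have h4 : ((R.k n j : ℝ) + 1 + 1) ≤ R.k n i := by exact_mod_cast h
  nlinarith

/-- A firing robot has the largest cycle number. -/
lemma k_le_of_fires {n : ℕ} {j : Fin N} (hj : R.k (n + 1) j = R.k n j + 1) (i : Fin N) :
    R.k (n + 1) i ≤ R.k (n + 1) j := by
  have h1 := R.phase_nonneg (n + 1) i
  have h2 := (R.firesIn_of_fires hj).front
  have h3 := R.x_sub_x_lt (n + 1) i j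
  have hπ := Real.pi_pos
  by_contra! h
  have h4 : ((R.k (n + 1) j : ℝ) + 1) ≤ R.k (n + 1) i := by exact_mod_cast h
  nlinarith

/-- Firing instances do not accumulate: each of them increases the sum of the cycle numbers, which
is controlled by the elapsed time because the headings stay bounded. -/
lemma tendsto_T (hω₀ : 0 < ω₀) : Tendsto R.T atTop atTop := by
  obtain ⟨A, l, hl, h⟩ := R.spread
  have hsum : ∀ n : ℕ, (n : ℤ) + ∑ i, R.k 0 i ≤ ∑ i, R.k n i := by
    intro n
    induction n with
    | zero => simp
    | succ n ih =>
      obtain ⟨j, hj⟩ := R.exists_fires n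
      have : ∑ i, R.k n i < ∑ i, R.k (n + 1) i :=
        Finset.sum_lt_sum (fun i _ => R.monotone_k i (Nat.le_succ n))
          ⟨j, Finset.mem_univ _, by omega⟩
      push_cast
      omega
  have hN : 0 < (N : ℝ) := by
    obtain ⟨j, -⟩ := R.exists_fires 0
    exact_mod_cast j.pos
  have hlow : ∀ n : ℕ, (2 * Real.pi * (n + ∑ i, (R.k 0 i : ℝ)) - N * (A + l)) / (N * ω₀) ≤ R.T n := by
    intro n
    rw [div_le_iff₀ (by positivity)]
    have h1 : ∑ i, 2 * Real.pi * (R.k n i : ℝ) ≤ ∑ _i : Fin N, ((A + l) + ω₀ * R.T n) :=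
      Finset.sum_le_sum fun i _ => by linarith [R.phase_nonneg n i, (h n i).1.2]
    rw [← Finset.mul_sum, Finset.sum_const, Finset.card_univ, Fintype.card_fin, nsmul_eq_mul] at h1
    have h2 : (n : ℝ) + ∑ i, (R.k 0 i : ℝ) ≤ ∑ i, (R.k n i : ℝ) := by exact_mod_cast hsum n
    nlinarith [Real.pi_pos]
  refine tendsto_atTop_mono hlow ?_
  refine Tendsto.atTop_div_const (by positivity) ?_
  refine tendsto_atTop_add_const_right _ _ ?_
  refine Tendsto.const_mul_atTop (by positivity) ?_
  exact tendsto_atTop_add_const_right _ _ tendsto_natCast_atTop_atTop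

lemma exists_firesIn (hω₀ : 0 < ω₀) {i : Fin N} {n₀ : ℕ} {q : ℤ} (h : R.k n₀ i < q) :
    ∃ n, n₀ ≤ n ∧ R.FiresIn q i n := by
  obtain ⟨A, l, hl, hA⟩ := R.spread
  have hex : ∃ n, q ≤ R.k n i := by
    obtain ⟨n, hn⟩ := ((R.tendsto_T hω₀).eventually_ge_atTop ((2 * Real.pi * q - A) / ω₀)).exists
    refine ⟨n, ?_⟩
    rw [div_le_iff₀ hω₀] at hn
    have h1 := R.phase_lt n i
    by_contra! h2
    have h3 : (R.k n i : ℝ) + 1 ≤ q := by exact_mod_cast h2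
    nlinarith [Real.pi_pos, (hA n i).1.1]
  classical
  have hspec := Nat.find_spec hex
  have hmin := fun m => Nat.find_min hex (m := m)
  generalize Nat.find hex = p at hspec hmin
  have hp : n₀ < p := by
    by_contra! hle
    have := R.monotone_k i hle
    simp only at this
    omega
  obtain ⟨p, rfl⟩ : ∃ p', p = p' + 1 := ⟨p - 1, by omega⟩
  refine ⟨p, by omega, ?_⟩
  have h1 := hmin p (by omega)
  rcases R.k_step p i with h | h
  · omega
  · constructor <;> omega

variable {R} in
lemma FiresIn.lt_of_le {q : ℤ} {i : Fin N} {n p : ℕ} (h : R.FiresIn q i n) (hp : q ≤ R.k p i) :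
    n < p := by
  by_contra! hle
  have h1 : R.k p i ≤ R.k n i := R.monotone_k i hle
  have := h.1
  omega

variable {R} in
lemma FiresIn.le_of_lt {q : ℤ} {i : Fin N} {n p : ℕ} (h : R.FiresIn q i n) (hp : R.k p i < q) :
    p ≤ n := by
  by_contra! hle
  have h1 : R.k (n + 1) i ≤ R.k p i := R.monotone_k i hle
  have := h.2
  omega

/-! ### The containing interval is nested -/

lemma le_mul_x_succ (hωmax : 0 < ωmax) {σ : ℝ} (hσ : σ = 1 ∨ σ = -1) {b : ℝ} {n : ℕ} {i : Fin N}
    (hx : b ≤ σ * R.x n i) (hg : b ≤ σ * R.g n i) : b ≤ σ * R.x (n + 1) i := by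
  have hs : 0 < ωmax * (R.T (n + 1) - R.T n) := mul_pos hωmax (sub_pos.2 (R.T_lt n))
  rcases hσ with rfl | rfl
  · have := R.move_lower n i
    rcases min_le_iff.1 this with h | h <;> linarith
  · have := R.move_upper n i
    rcases le_max_iff.1 this with h | h <;> linarith

/-- Targets computed at a pulse are convex combinations. -/
lemma le_mul_target (hα : α ∈ Set.Ioc (0 : ℝ) 1) {σ m b y z : ℝ} (hy : m ≤ σ * y) (hz : b ≤ σ * z) :
    m + α * (b - m) ≤ σ * (y + α * (z - y)) := by
  nlinarith [mul_nonneg hα.1.le (sub_nonneg.2 hz), mul_nonneg (sub_nonneg.2 hα.2) (sub_nonneg.2 hy)]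

variable {R} in
lemma Bound.mono (hωmax : 0 < ωmax) (hα : α ∈ Set.Ioc (0 : ℝ) 1) {σ : ℝ} (hσ : σ = 1 ∨ σ = -1)
    {b : ℝ} {n p : ℕ} (h : R.Bound σ n b) (hnp : n ≤ p) : R.Bound σ p b := by
  induction p, hnp using Nat.le_induction with
  | base => exact h
  | succ p hp ih =>
    have hx : ∀ i, b ≤ σ * R.x (p + 1) i := fun i => R.le_mul_x_succ hωmax hσ (ih i).1 (ih i).2
    refine fun i => ⟨hx i, ?_⟩
    rcases R.target_step p i with h | ⟨j, -, h⟩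
    · rw [h]; exact (ih i).2
    · rw [h]; simpa using le_mul_target hα (hx i) (hx j)

/-! ### Propagation of leading headings within a cycle -/

/-- If `j` fires in a cycle at a heading `δ` above the lower bound `m`, a robot `i` that hears `j`
fires in the same cycle at a heading at least `c δ` above `m`: if `i` lags, then it starts to advance
at the pulse of `j`, and until its own firing all pulses it hears come from robots ahead of it. -/
lemma propagate_edge (hω₀ : 0 < ω₀) (hωmax : 0 < ωmax) (hα : α ∈ Set.Ioc (0 : ℝ) 1)
    {c : ℝ} (hc0 : 0 < c) (hc1 : c ≤ 1 / 2) (hc2 : c ≤ α / 2) (hc3 : c ≤ ωmax / (2 * ω₀))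
    {i j : Fin N} (hadj : G.Adj j i) {n₀ : ℕ} {m : ℝ} (hm : R.Bound 1 n₀ m) {q : ℤ}
    (hq : ∀ i, R.k n₀ i < q) {a b : ℕ} (ha : R.FiresIn q j a) (hb : R.FiresIn q i b)
    {δ : ℝ} (hδ : 0 ≤ δ) (hy : m + δ ≤ R.x (a + 1) j) : m + c * δ ≤ R.x (b + 1) i := by
  have hfa := ha.front
  have hfb := hb.front
  have hcδ : c * δ ≤ 1 / 2 * δ := mul_le_mul_of_nonneg_right hc1 hδ
  have hcδ2 : c * δ ≤ α / 2 * δ := mul_le_mul_of_nonneg_right hc2 hδ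
  have hcδ3 : c * δ ≤ ωmax / (2 * ω₀) * δ := mul_le_mul_of_nonneg_right hc3 hδ
  -- after the time `δ / (2 ω₀)` at full speed the heading has advanced by at least `c δ`
  have hslow : ∀ s : ℝ, 1 / 2 * δ ≤ ω₀ * s → c * δ ≤ ωmax * s := by
    intro s hs
    have : ωmax / (2 * ω₀) * δ = ωmax / ω₀ * (1 / 2 * δ) := by field_simp
    have h2 : ωmax / ω₀ * (1 / 2 * δ) ≤ ωmax / ω₀ * (ω₀ * s) := by gcongr
    have h3 : ωmax / ω₀ * (ω₀ * s) = ωmax * s := by field_simp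
    linarith
  rcases le_or_gt b a with hba | hab
  · have : R.T (b + 1) ≤ R.T (a + 1) := R.monotone_T (by omega)
    nlinarith
  have hm' : ∀ p, n₀ ≤ p → ∀ i, m ≤ R.x p i := fun p hp i => by
    simpa using (hm.mono hωmax hα (Or.inl rfl) hp i).1
  have han : n₀ ≤ a := ha.le_of_lt (hq j)
  -- `i` has not fired in the cycle before the instance `b + 1`
  have hlag : ∀ p, p ≤ b → R.x p i + ω₀ * R.T p < 2 * Real.pi * q := by
    intro p hp
    have h1 : R.k p i ≤ R.k b i := R.monotone_k i hp
    have h2 : R.k p i + 1 ≤ q := by have := hb.1; omega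
    have h3 : (R.k p i : ℝ) + 1 ≤ q := by exact_mod_cast h2
    have := R.phase_lt p i
    nlinarith [Real.pi_pos]
  have key : ∀ p, a + 1 ≤ p → p ≤ b →
      m + min (ωmax * (R.T p - R.T (a + 1))) (c * δ) ≤ R.x p i ∧ m + c * δ ≤ R.g p i := by
    intro p hp
    induction p, hp using Nat.le_induction with
    | base =>
      intro hpb
      have hx := hm' (a + 1) (by omega) i
      refine ⟨?_, ?_⟩
      · rw [sub_self, mul_zero]
        linarith [min_le_left 0 (c * δ)]
      · rw [R.target_of_lag a i j hadj (by rw [ha.2, ha.1]) (by linarith [hlag _ hpb])]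
        nlinarith [le_mul_target (σ := 1) hα (by simpa using hx) (by simpa using hy), hα.1]
    | succ p hp ih =>
      intro hpb
      obtain ⟨ih1, ih2⟩ := ih (by omega)
      have hs : 0 < ωmax * (R.T (p + 1) - R.T p) := mul_pos hωmax (sub_pos.2 (R.T_lt p))
      have hx1 : m + min (ωmax * (R.T (p + 1) - R.T (a + 1))) (c * δ) ≤ R.x (p + 1) i := by
        rcases min_le_iff.1 (R.move_lower p i) with h | h
        · rcases min_le_iff.1 (le_refl (min (ωmax * (R.T p - R.T (a + 1))) (c * δ))) with h' | h'
          · linarith [min_le_left (ωmax * (R.T (p + 1) - R.T (a + 1))) (c * δ)]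
          · linarith [min_le_right (ωmax * (R.T (p + 1) - R.T (a + 1))) (c * δ)]
        · linarith [min_le_right (ωmax * (R.T (p + 1) - R.T (a + 1))) (c * δ)]
      refine ⟨hx1, ?_⟩
      rcases R.target_step p i with h | ⟨j', hj', h⟩
      · rw [h]; exact ih2
      · rw [h]
        have hxm := hm' (p + 1) (by omega) i
        -- the firing robot is in cycle at least `q`, hence at or ahead of the front
        have hk : q ≤ R.k (p + 1) j' := by
          have h1 := R.k_le_of_fires hj' j
          have h2 : R.k (a + 1) j ≤ R.k (p + 1) j := R.monotone_k j (by omega)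
          have := ha.2
          omega
        have hk' : (q : ℝ) ≤ R.k (p + 1) j' := by exact_mod_cast hk
        have hf' := (R.firesIn_of_fires hj').front
        have hfront : 2 * Real.pi * q ≤ R.x (p + 1) j' + ω₀ * R.T (p + 1) := by
          rw [hf']; nlinarith [Real.pi_pos]
        have hl := hlag _ hpb
        rcases le_or_gt (ω₀ * (R.T (p + 1) - R.T (a + 1))) (1 / 2 * δ) with hshort | hlong
        · have hxj : m + 1 / 2 * δ ≤ R.x (p + 1) j' := by linarith
          have := le_mul_target (σ := 1) hα (by simpa using hxm) (by simpa using hxj)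
          nlinarith
        · have h1 := hslow _ hlong.le
          rw [min_eq_right h1] at hx1
          nlinarith [hα.1]
  obtain ⟨h1, h2⟩ := key b (by omega) le_rfl
  rcases le_or_gt (ω₀ * (R.T (b + 1) - R.T (a + 1))) (1 / 2 * δ) with hshort | hlong
  · linarith
  · have h3 := hslow _ hlong.le
    rcases min_le_iff.1 (R.move_lower b i) with h | h
    · rcases min_le_iff.1 (le_refl (min (ωmax * (R.T b - R.T (a + 1))) (c * δ))) with h' | h'
      · linarith
      · have hs : 0 < ωmax * (R.T (b + 1) - R.T b) := mul_pos hωmax (sub_pos.2 (R.T_lt b))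
        linarith
    · linarith

/-- By strong connectivity, one robot firing at a heading `δ` above the lower bound `m` makes all
robots fire in the same cycle at headings at least `C δ` above `m`. -/
lemma propagate (hω₀ : 0 < ω₀) (hωmax : 0 < ωmax) (hα : α ∈ Set.Ioc (0 : ℝ) 1)
    (hG : StronglyConnected G) :
    ∃ C : ℝ, 0 < C ∧ C ≤ 1 ∧ ∀ (i j : Fin N) (n₀ : ℕ) (m : ℝ) (q : ℤ) (a b : ℕ) (δ : ℝ),
      R.Bound 1 n₀ m → (∀ i, R.k n₀ i < q) → R.FiresIn q j a → R.FiresIn q i b → 0 ≤ δ →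
      m + δ ≤ R.x (a + 1) j → m + C * δ ≤ R.x (b + 1) i := by
  obtain ⟨c, hc0, hc1, hc2, hc3⟩ : ∃ c : ℝ, 0 < c ∧ c ≤ 1 / 2 ∧ c ≤ α / 2 ∧ c ≤ ωmax / (2 * ω₀) := by
    refine ⟨min (1 / 2) (min (α / 2) (ωmax / (2 * ω₀))), ?_, min_le_left _ _,
      (min_le_right _ _).trans (min_le_left _ _), (min_le_right _ _).trans (min_le_right _ _)⟩
    have := hα.1
    positivity
  have hpair : ∀ i j : Fin N, ∃ C : ℝ, 0 < C ∧ ∀ (n₀ : ℕ) (m : ℝ) (q : ℤ) (a b : ℕ) (δ : ℝ),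
      R.Bound 1 n₀ m → (∀ i, R.k n₀ i < q) → R.FiresIn q j a → R.FiresIn q i b → 0 ≤ δ →
      m + δ ≤ R.x (a + 1) j → m + C * δ ≤ R.x (b + 1) i := by
    intro i j
    have hji := hG j i
    induction hji with
    | refl =>
      refine ⟨1, one_pos, fun n₀ m q a b δ hm hq ha hb hδ hy => ?_⟩
      have h1 := ha.lt_of_le hb.2.ge
      have h2 := hb.lt_of_le ha.2.ge
      obtain rfl : a = b := by omega
      linarith
    | @tail i' i _ hadj ih =>
      obtain ⟨C, hC, h⟩ := ih
      refine ⟨c * C, mul_pos hc0 hC, fun n₀ m q a b δ hm hq ha hb hδ hy => ?_⟩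
      obtain ⟨a', -, ha'⟩ := R.exists_firesIn hω₀ (hq i')
      have := R.propagate_edge hω₀ hωmax hα hc0 hc1 hc2 hc3 hadj hm hq ha' hb
        (mul_nonneg hC.le hδ) (h n₀ m q a a' δ hm hq ha ha' hδ hy)
      linarith
  choose C hC h using hpair
  have hne : Nonempty (Fin N × Fin N) := by
    obtain ⟨j, -⟩ := R.exists_fires 0
    exact ⟨(j, j)⟩
  obtain ⟨p₀, hp₀⟩ := Finite.exists_min fun p : Fin N × Fin N => C p.1 p.2
  refine ⟨min 1 (C p₀.1 p₀.2), lt_min one_pos (hC _ _), min_le_left _ _,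
    fun i j n₀ m q a b δ hm hq ha hb hδ hy => ?_⟩
  have h1 := h i j n₀ m q a b δ hm hq ha hb hδ hy
  have h2 : min 1 (C p₀.1 p₀.2) * δ ≤ C i j * δ :=
    mul_le_mul_of_nonneg_right ((min_le_right _ _).trans (hp₀ (i, j))) hδ
  linarith

/-! ### Persistence over cycles -/

lemma abs_g_sub_x_succ_le (hωmax : 0 < ωmax) (n : ℕ) (i : Fin N) :
    |R.g n i - R.x (n + 1) i| ≤ max 0 (|R.g n i - R.x n i| - ωmax * (R.T (n + 1) - R.T n)) := by
  have hs : 0 < ωmax * (R.T (n + 1) - R.T n) := mul_pos hωmax (sub_pos.2 (R.T_lt n))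
  have h1 := R.move_lower n i
  have h2 := R.move_upper n i
  rw [le_max_iff, abs_nonpos_iff, sub_eq_zero, abs_le, abs_eq_max_neg]
  rcases min_le_iff.1 h1 with h1 | h1 <;> rcases le_max_iff.1 h2 with h2 | h2
  · linarith
  · right
    have := le_max_left (R.g n i - R.x n i) (-(R.g n i - R.x n i))
    constructor <;> linarith
  · right
    have := le_max_right (R.g n i - R.x n i) (-(R.g n i - R.x n i))
    constructor <;> linarith
  · left; linarith

/-- If over sufficiently many consecutive cycles all robots fire at headings at a distance at least
`b - m` from an end of the containing interval (the lower end for `σ = 1`, the upper one for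
`σ = -1`), then the interval shrinks at this end by `α (b - m)`: adjustments begun before these cycles
have run out or been replaced, and those begun since have targets away from this end. -/
lemma Bound.window (hω₀ : 0 < ω₀) (hωmax : 0 < ωmax) (hα : α ∈ Set.Ioc (0 : ℝ) 1)
    {σ : ℝ} (hσ : σ = 1 ∨ σ = -1) {n₀ n K : ℕ} {m b : ℝ} {q : ℤ} (h₀ : R.Bound σ n₀ m)
    (hmb : m ≤ b) (hq : ∀ i, R.k n₀ i < q) (hn : ∀ i, q + K ≤ R.k n i)
    (hK : ω₀ * Real.pi ≤ ωmax * (2 * Real.pi * K - Real.pi))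
    (H : ∀ j p, p < n → R.k (p + 1) j = R.k p j + 1 → q ≤ R.k (p + 1) j → b ≤ σ * R.x (p + 1) j) :
    R.Bound σ n (m + α * (b - m)) := by
  have hb' : m + α * (b - m) ≤ b := by nlinarith [hα.2]
  intro i
  obtain ⟨a, ha₀, ha⟩ := R.exists_firesIn hω₀ (hq i)
  obtain ⟨a', haa', ha'⟩ := R.exists_firesIn hω₀ (q := q + K) (i := i) (n₀ := a)
    (by have := ha.1; omega)
  have ha'n : a' < n := ha'.lt_of_le (hn i)
  have hstep : ∀ p, a + 1 ≤ p → p < n →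
      R.g (p + 1) i = R.g p i ∨ m + α * (b - m) ≤ σ * R.g (p + 1) i := by
    intro p hp hpn
    rcases R.target_step p i with h | ⟨j, hj, h⟩
    · exact Or.inl h
    · right
      rw [h]
      refine le_mul_target hα (h₀.mono hωmax hα hσ (by omega) i).1 (H j p hpn hj ?_)
      have h1 := R.k_le_of_fires hj i
      have h2 : R.k (a + 1) i ≤ R.k (p + 1) i := R.monotone_k i (by omega)
      have := ha.2
      omega
  have hrun : ∀ p, a + 1 ≤ p → p ≤ n → m + α * (b - m) ≤ σ * R.g p i ∨
      |R.g p i - R.x p i| ≤ max 0 (Real.pi - ωmax * (R.T p - R.T (a + 1))) := by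
    intro p hp
    induction p, hp using Nat.le_induction with
    | base =>
      intro _
      right
      rw [sub_self, mul_zero, sub_zero]
      exact (R.abs_g_sub_x_lt _ _).le.trans (le_max_right _ _)
    | succ p hp ih =>
      intro hpn
      rcases hstep p hp (by omega) with h | h
      · rw [h]
        refine (ih (by omega)).imp_right fun ih => ?_
        have hs : 0 < ωmax * (R.T (p + 1) - R.T p) := mul_pos hωmax (sub_pos.2 (R.T_lt p))
        rcases le_max_iff.1 (R.abs_g_sub_x_succ_le hωmax p i) with h1 | h1
        · exact h1.trans (le_max_left _ _)
        · rcases le_max_iff.1 ih with h2 | h2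
          · exact le_max_of_le_left (by linarith)
          · exact le_max_of_le_right (by linarith)
      · exact Or.inl h
  have hxa' : b ≤ σ * R.x (a' + 1) i :=
    H i a' ha'n (by rw [ha'.2, ha'.1]) (by rw [ha'.2]; omega)
  have hga' : m + α * (b - m) ≤ σ * R.g (a' + 1) i := by
    rcases hrun (a' + 1) (by omega) (by omega) with h | h
    · exact h
    · have h1 := ha.front
      have h2 := ha'.front
      push_cast at h2
      have h3 := (abs_lt.1 (R.abs_x_sub_lt (a' + 1) (a + 1) i)).2
      have h4 : 2 * Real.pi * K - Real.pi ≤ ω₀ * (R.T (a' + 1) - R.T (a + 1)) := by linarith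
      have h5 : ω₀ * Real.pi ≤ ω₀ * (ωmax * (R.T (a' + 1) - R.T (a + 1))) := by nlinarith
      have h6 := le_of_mul_le_mul_left h5 hω₀
      rw [max_eq_left (by linarith), abs_nonpos_iff, sub_eq_zero] at h
      rw [h]
      exact hb'.trans hxa'
  have hend : ∀ p, a' + 1 ≤ p → p ≤ n →
      m + α * (b - m) ≤ σ * R.x p i ∧ m + α * (b - m) ≤ σ * R.g p i := by
    intro p hp
    induction p, hp using Nat.le_induction with
    | base => exact fun _ => ⟨hb'.trans hxa', hga'⟩
    | succ p hp ih =>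
      intro hpn
      obtain ⟨ih1, ih2⟩ := ih (by omega)
      refine ⟨R.le_mul_x_succ hωmax hσ ih1 ih2, ?_⟩
      rcases hstep p (by omega) (by omega) with h | h
      · rw [h]; exact ih2
      · exact h
  exact hend n (by omega) le_rfl

/-- If all robots fire in cycle `q` at headings at least `β`, then some robot does so in cycle
`q + 1`, unless the whole containing interval has dropped below `β`: after its firing in cycle `q`, a
robot that responds is ahead of the pulse, hence above `β`, so that it can only get below `β` by
following a target below `β`. -/
lemma persist (hω₀ : 0 < ω₀) (hωmax : 0 < ωmax) (hα : α ∈ Set.Ioc (0 : ℝ) 1) [Nonempty (Fin N)]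
    {n₀ : ℕ} {q : ℤ} {β : ℝ} (hq : ∀ i, R.k n₀ i < q)
    (H : ∀ i p, R.FiresIn q i p → β ≤ R.x (p + 1) i) :
    (∃ j p, R.FiresIn (q + 1) j p ∧ β ≤ R.x (p + 1) j) ∨ ∃ n, n₀ ≤ n ∧ R.Bound (-1) n (-β) := by
  classical
  have hex : ∃ n, ∃ j, q + 1 ≤ R.k (n + 1) j := by
    obtain ⟨i⟩ := ‹Nonempty (Fin N)›
    obtain ⟨n, -, hn⟩ := R.exists_firesIn hω₀ (q := q + 1) (i := i) (n₀ := n₀) (by linarith [hq i])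
    exact ⟨n, i, hn.2.ge⟩
  obtain ⟨j, hj⟩ := Nat.find_spec hex
  have hmin := fun m => Nat.find_min hex (m := m)
  generalize Nat.find hex = n at hj hmin
  have hk : ∀ i, R.k n i ≤ q := by
    intro i
    by_contra! h
    rcases Nat.eq_zero_or_pos n with rfl | hn
    · have h1 : R.k 0 i ≤ R.k n₀ i := R.monotone_k i (Nat.zero_le _)
      linarith [hq i]
    · exact hmin (n - 1) (by omega) ⟨i, by rw [Nat.sub_add_cancel hn]; exact h⟩
  have hjf : R.FiresIn (q + 1) j n := by
    have := hk j
    rcases R.k_step n j with h | h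
    · omega
    · constructor <;> omega
  have hjfires : R.k (n + 1) j = R.k n j + 1 := by rw [hjf.2, hjf.1]
  have hn₀ : n₀ ≤ n := hjf.le_of_lt (by linarith [hq j])
  rw [or_iff_not_imp_left]
  intro hnot
  have hyj : R.x (n + 1) j < β := by
    by_contra! h
    exact hnot ⟨j, n, hjf, h⟩
  have hfj := hjf.front
  have hxj : ∀ i, R.x (n + 1) i ≤ R.x (n + 1) j := by
    intro i
    rcases R.k_step n i with h | h
    · have h1 := R.phase_lt (n + 1) i
      have h2 : (R.k (n + 1) i : ℝ) ≤ q := by rw [h]; exact_mod_cast hk i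
      push_cast at hfj
      nlinarith [Real.pi_pos]
    · have h2 : (R.k (n + 1) i : ℝ) ≤ q + 1 := by rw [h.1]; exact_mod_cast add_le_add_left (hk i) 1
      push_cast at hfj
      nlinarith [Real.pi_pos, h.2]
  have hg : ∀ i, R.g n i < β := by
    intro i
    have hki : q ≤ R.k n i := by
      have h1 := R.k_le_k_add_one (n + 1) j i
      have h2 := hjf.2
      rcases R.k_step n i with h | h
      · omega
      · have := R.k_le_of_fires h.1 j
        omega
    obtain ⟨a, -, ha⟩ := R.exists_firesIn hω₀ (hq i)
    have han : a + 1 ≤ n := ha.lt_of_le hki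
    have key : ∀ p, a + 1 ≤ p → p ≤ n → β ≤ R.g p i → β ≤ R.x p i := by
      intro p hp
      induction p, hp using Nat.le_induction with
      | base => exact fun _ _ => H i a ha
      | succ p hp ih =>
        intro hpn hgp
        rcases R.target_step p i with h | ⟨j', hj', h⟩
        · rw [h] at hgp
          simpa using R.le_mul_x_succ hωmax (σ := 1) (b := β) (Or.inl rfl)
            (by simpa using ih (by omega) hgp) (by simpa using hgp)
        · have h1 := R.k_le_of_fires hj' i
          have h2 : R.k (a + 1) i ≤ R.k (p + 1) i := R.monotone_k i (by omega)
          have h3 : R.k (p + 1) j' ≤ R.k n j' := R.monotone_k j' hpn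
          have h4 := hk j'
          have h5 := ha.2
          have h6 : R.FiresIn q j' p := ⟨by omega, by omega⟩
          have h7 := h6.front
          have h8 := R.phase_nonneg (p + 1) i
          have h9 : (q : ℝ) ≤ R.k (p + 1) i := by exact_mod_cast (by omega : q ≤ R.k (p + 1) i)
          nlinarith [H j' p h6, Real.pi_pos]
    by_contra! hβ
    have h1 := R.le_mul_x_succ hωmax (σ := 1) (b := β) (Or.inl rfl)
      (by simpa using key n han le_rfl hβ) (by simpa using hβ)
    linarith [hxj i]
  refine ⟨n + 1, by omega, fun i => ⟨by linarith [hxj i], ?_⟩⟩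
  rcases R.target_step n i with h | ⟨j', hj', h⟩
  · rw [h]; linarith [hg i]
  · rw [h]
    have := le_mul_target (σ := -1) (m := -R.x (n + 1) j) (b := -R.x (n + 1) j) hα
      (by linarith [hxj i] : _ ≤ -1 * R.x (n + 1) i) (by linarith [hxj j'] : _ ≤ -1 * R.x (n + 1) j')
    linarith

/-! ### Contraction -/

/-- If all robots fire below the midpoint of the containing interval over a window of cycles, its
upper end drops. Otherwise some robot fires above the midpoint, and by `propagate` and `persist` either
the whole interval later drops below the midpoint, or over the following window all robots fire
well above the lower end, which then rises. -/
lemma contraction (hω₀ : 0 < ω₀) (hωmax : 0 < ωmax) (hα : α ∈ Set.Ioc (0 : ℝ) 1)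
    (hG : StronglyConnected G) :
    ∃ ρ : ℝ, 0 ≤ ρ ∧ ρ < 1 ∧ ∀ (n : ℕ) (m M : ℝ), R.Bound 1 n m → R.Bound (-1) n (-M) →
      ∃ (n' : ℕ) (m' M' : ℝ), R.Bound 1 n' m' ∧ R.Bound (-1) n' (-M') ∧
        M' - m' ≤ ρ * (M - m) := by
  obtain ⟨C, hC0, hC1, hC⟩ := R.propagate hω₀ hωmax hα hG
  have hπ := Real.pi_pos
  obtain ⟨K, hK⟩ : ∃ K : ℕ, ω₀ * Real.pi ≤ ωmax * (2 * Real.pi * K - Real.pi) := by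
    obtain ⟨K, hK⟩ := exists_nat_ge ((ω₀ * Real.pi / ωmax + Real.pi) / (2 * Real.pi))
    refine ⟨K, ?_⟩
    rw [div_le_iff₀ (by positivity)] at hK
    have : ωmax * (ω₀ * Real.pi / ωmax) = ω₀ * Real.pi := by field_simp
    nlinarith
  have hCK0 : 0 < C ^ (K + 2) := pow_pos hC0 _
  have hCK1 : C ^ (K + 2) ≤ 1 := pow_le_one₀ hC0.le hC1
  have hαC : α * C ^ (K + 2) ≤ 1 := by nlinarith [hα.1, hα.2]
  obtain ⟨i₀, -⟩ := R.exists_fires 0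
  have : Nonempty (Fin N) := ⟨i₀⟩
  refine ⟨1 - α * C ^ (K + 2) / 2, by linarith, by have := mul_pos hα.1 hCK0; linarith,
    fun n m M hm hM => ?_⟩
  have hΛ : 0 ≤ M - m := by linarith [(hm i₀).1, (hM i₀).1]
  obtain ⟨B, hB⟩ := (Set.finite_range (R.k n)).bddAbove
  have hq : ∀ i, R.k n i < B + 1 := fun i => Int.lt_add_one_of_le (hB (Set.mem_range_self i))
  -- an instance at which all robots have just completed `K` cycles after cycle `q`
  have hwin : ∀ q, B + 1 ≤ q → ∃ n₁, n ≤ n₁ ∧ (∀ i, q + K ≤ R.k n₁ i) ∧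
      ∀ i, R.k n₁ i ≤ q + K + 1 := by
    intro q hBq
    obtain ⟨n₁, hn₁, h⟩ := R.exists_firesIn hω₀ (q := q + K + 1) (i := i₀) (n₀ := n)
      (by linarith [hq i₀])
    have h2 := h.2
    refine ⟨n₁ + 1, by omega, fun i => ?_, fun i => ?_⟩
    · have := R.k_le_k_add_one (n₁ + 1) i₀ i
      omega
    · rw [← h.2]; exact R.k_le_of_fires (by rw [h.2, h.1]) i
  obtain ⟨n₁, hn₁, hn₁k, -⟩ := hwin (B + 1) le_rfl
  by_cases H1 : ∀ j p, p < n₁ → R.k (p + 1) j = R.k p j + 1 → B + 1 ≤ R.k (p + 1) j →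
      -M + (M - m) / 2 ≤ -1 * R.x (p + 1) j
  · have h := Bound.window R hω₀ hωmax hα (Or.inr rfl) hM (by linarith) hq hn₁k hK H1
    refine ⟨n₁, m, M - α * ((M - m) / 2), hm.mono hωmax hα (Or.inl rfl) hn₁, ?_, ?_⟩
    · convert h using 1; ring
    · nlinarith [mul_nonneg hα.1.le hΛ]
  push Not at H1
  obtain ⟨j, p, -, hjp, hr, hx⟩ := H1
  generalize hrdef : R.k (p + 1) j = r at hr
  have hqr : ∀ s : ℕ, ∀ i, R.k n i < r + s := fun s i => by linarith [hq i, Int.natCast_nonneg s]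
  by_cases H2 : ∃ n', n ≤ n' ∧ R.Bound (-1) n' (-(m + (M - m) / 2))
  · obtain ⟨n', hn', h⟩ := H2
    refine ⟨n', m, m + (M - m) / 2, hm.mono hωmax hα (Or.inl rfl) hn', h, ?_⟩
    nlinarith
  have hall : ∀ s : ℕ, (∃ j p, R.FiresIn (r + s) j p ∧ m + C ^ s * ((M - m) / 2) ≤ R.x (p + 1) j) →
      ∀ i p, R.FiresIn (r + s) i p → m + C ^ (s + 1) * ((M - m) / 2) ≤ R.x (p + 1) i := by
    rintro s ⟨j, a, ha, hy⟩ i b hb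
    have := hC i j n m (r + s) a b _ hm (hqr s) ha hb (by positivity) hy
    rw [pow_succ']
    linarith
  have hiter : ∀ s : ℕ, ∃ j p, R.FiresIn (r + s) j p ∧ m + C ^ s * ((M - m) / 2) ≤ R.x (p + 1) j := by
    intro s
    induction s with
    | zero =>
      refine ⟨j, p, ?_, ?_⟩
      · have := R.firesIn_of_fires hjp
        rw [hrdef] at this
        simpa using this
      · rw [pow_zero]; linarith
    | succ s ih =>
      rcases R.persist hω₀ hωmax hα (hqr s) (hall s ih) with h | ⟨n', hn', h⟩
      · push_cast
        rw [← add_assoc]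
        exact h
      · refine absurd ⟨n', hn', fun i => ?_⟩ H2
        have h1 : C ^ (s + 1) * ((M - m) / 2) ≤ 1 * ((M - m) / 2) :=
          mul_le_mul_of_nonneg_right (pow_le_one₀ hC0.le hC1) (by linarith)
        constructor <;> linarith [(h i).1, (h i).2]
  obtain ⟨n₂, hn₂, hn₂l, hn₂u⟩ := hwin r hr
  have h := Bound.window R hω₀ hωmax hα (Or.inl rfl) (b := m + C ^ (K + 2) * ((M - m) / 2)) hm
    (by have := mul_nonneg hCK0.le hΛ; linarith) (fun i => by simpa using hqr 0 i) hn₂l hK (by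
      intro j p hp hjp hk
      obtain ⟨s, hs⟩ := Int.eq_ofNat_of_zero_le (sub_nonneg.2 hk)
      have hs' : R.k (p + 1) j = r + s := by omega
      have h1 : R.k (p + 1) j ≤ R.k n₂ j := R.monotone_k j hp
      have h2 := hn₂u j
      have h3 := hall s (hiter s) j p ⟨by omega, hs'⟩
      have h4 : C ^ (K + 2) * ((M - m) / 2) ≤ C ^ (s + 1) * ((M - m) / 2) :=
        mul_le_mul_of_nonneg_right (pow_le_pow_of_le_one hC0.le hC1 (by omega)) (by linarith)
      linarith)
  refine ⟨n₂, _, M, h, hM.mono hωmax hα (Or.inr rfl) hn₂, le_of_eq (by ring)⟩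

/-- The containing interval becomes arbitrarily short. -/
lemma exists_bound (hω₀ : 0 < ω₀) (hωmax : 0 < ωmax) (hα : α ∈ Set.Ioc (0 : ℝ) 1)
    (hG : StronglyConnected G) {ε : ℝ} (hε : 0 < ε) :
    ∃ (n : ℕ) (m M : ℝ), R.Bound 1 n m ∧ R.Bound (-1) n (-M) ∧ M - m ≤ ε := by
  obtain ⟨ρ, hρ0, hρ1, hρ⟩ := R.contraction hω₀ hωmax hα hG
  obtain ⟨A, l, hl, hA⟩ := R.spread
  have hiter : ∀ s : ℕ, ∃ (n : ℕ) (m M : ℝ), R.Bound 1 n m ∧ R.Bound (-1) n (-M) ∧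
      M - m ≤ ρ ^ s * l := by
    intro s
    induction s with
    | zero =>
      refine ⟨0, A, A + l, fun i => ?_, fun i => ?_, by simp⟩
      · constructor <;> linarith [(hA 0 i).1.1, (hA 0 i).2.1]
      · constructor <;> linarith [(hA 0 i).1.2, (hA 0 i).2.2]
    | succ s ih =>
      obtain ⟨n, m, M, hm, hM, h⟩ := ih
      obtain ⟨n', m', M', hm', hM', h'⟩ := hρ n m M hm hM
      refine ⟨n', m', M', hm', hM', h'.trans ?_⟩
      rw [pow_succ', mul_assoc]
      exact mul_le_mul_of_nonneg_left h hρ0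
  have ht : Tendsto (fun s : ℕ => ρ ^ s * l) atTop (𝓝 0) := by
    simpa using (tendsto_pow_atTop_nhds_zero_of_lt_one hρ0 hρ1).mul_const l
  obtain ⟨s, hs⟩ := (ht.eventually_le_const hε).exists
  obtain ⟨n, m, M, hm, hM, h⟩ := hiter s
  exact ⟨n, m, M, hm, hM, h.trans hs⟩

end PulseRun

/-! ### One robot between firing instances -/

/-- The invariants of a single robot just after a firing instance: the phase is in `[0, 2π)`, an
adjustment runs at the rate `±ωmax` relative to `ω₀`, and an adjustment with a negative phase
rate ends before the phase gets negative. -/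
structure RobotState.Valid (ω₀ ωmax : ℝ) (x : RobotState) : Prop where
  phase_nonneg : 0 ≤ x.phase
  phase_lt : x.phase < 2 * Real.pi
  timer_nonneg : 0 ≤ x.timer
  rate : x.timer = 0 ∨ x.freq - ω₀ = ωmax ∨ x.freq - ω₀ = -ωmax
  end_nonneg : 0 ≤ x.freq ∨ 0 ≤ x.phase + x.freq * x.timer

/-- The heading at which the current adjustment ends. -/
def RobotState.target (ω₀ : ℝ) (x : RobotState) : ℝ := x.heading + (x.freq - ω₀) * x.timer

namespace RobotState

variable {ω₀ ωmax : ℝ} {x : RobotState}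

lemma target_flow (s : ℝ) : (x.flow ω₀ s).target ω₀ = x.target ω₀ := by
  simp only [target, flow]; ring

lemma phase_flow (s : ℝ) :
    (x.flow ω₀ s).phase = x.phase + ((x.flow ω₀ s).heading - x.heading) + ω₀ * s := by
  simp only [flow]; ring

lemma continuous_phase_flow : Continuous fun s => (x.flow ω₀ s).phase := by
  simp only [flow]; fun_prop

lemma Valid.min_le_heading_flow (h : x.Valid ω₀ ωmax) (hωmax : 0 < ωmax) {s : ℝ} (hs : 0 ≤ s) :
    min (x.heading + ωmax * s) (x.target ω₀) ≤ (x.flow ω₀ s).heading := by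
  simp only [target, flow]
  have := h.timer_nonneg
  rcases h.rate with h | h | h
  · simp [h, hs]
  · rw [h]
    rcases le_total s x.timer with hst | hst
    · rw [min_eq_left hst]; exact min_le_left _ _
    · rw [min_eq_right hst]; exact min_le_right _ _
  · rw [h]
    refine (min_le_right _ _).trans ?_
    nlinarith [min_le_right s x.timer]

lemma Valid.heading_flow_le_max (h : x.Valid ω₀ ωmax) (hωmax : 0 < ωmax) {s : ℝ} (hs : 0 ≤ s) :
    (x.flow ω₀ s).heading ≤ max (x.heading - ωmax * s) (x.target ω₀) := by
  simp only [target, flow]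
  have := h.timer_nonneg
  rcases h.rate with h | h | h
  · simp [h, hs]
  · rw [h]
    refine le_trans ?_ (le_max_right _ _)
    nlinarith [min_le_right s x.timer]
  · rw [h]
    rcases le_total s x.timer with hst | hst
    · rw [min_eq_left hst]; exact le_trans (by linarith) (le_max_left _ _)
    · rw [min_eq_right hst]; exact le_max_right _ _

lemma Valid.abs_heading_flow_sub_le (h : x.Valid ω₀ ωmax) (hωmax : 0 < ωmax) {s t : ℝ}
    (hs : 0 ≤ s) (ht : 0 ≤ t) :
    |(x.flow ω₀ t).heading - (x.flow ω₀ s).heading| ≤ ωmax * |t - s| := by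
  have e : (x.flow ω₀ t).heading - (x.flow ω₀ s).heading =
      (x.freq - ω₀) * (min t x.timer - min s x.timer) := by simp only [flow]; ring
  have hmin : |min t x.timer - min s x.timer| ≤ |t - s| := by
    simpa using abs_min_sub_min_le_max t x.timer s x.timer
  rw [e, abs_mul]
  rcases h.rate with h | h | h
  · simp [h, hs, ht]; positivity
  · rw [h, abs_of_pos hωmax]; gcongr
  · rw [h, abs_neg, abs_of_pos hωmax]; gcongr

lemma heading_flow_zero (h : x.Valid ω₀ ωmax) : (x.flow ω₀ 0).heading = x.heading := by
  simp [flow, h.timer_nonneg]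

lemma phase_flow_zero (h : x.Valid ω₀ ωmax) : (x.flow ω₀ 0).phase = x.phase := by
  simp [flow, h.timer_nonneg]

lemma Valid.exists_two_pi_le_phase_flow (h : x.Valid ω₀ ωmax) (hω₀ : 0 < ω₀) :
    ∃ s, 0 ≤ s ∧ 2 * Real.pi ≤ (x.flow ω₀ s).phase := by
  have h0 := h.timer_nonneg
  refine ⟨x.timer + (2 * Real.pi + |x.freq * x.timer|) / ω₀, by positivity, ?_⟩
  have hle : x.timer ≤ x.timer + (2 * Real.pi + |x.freq * x.timer|) / ω₀ := by
    have : 0 ≤ (2 * Real.pi + |x.freq * x.timer|) / ω₀ := by positivity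
    linarith
  simp only [flow, min_eq_right hle, add_sub_cancel_left, mul_div_cancel₀ _ hω₀.ne']
  linarith [h.phase_nonneg, neg_abs_le (x.freq * x.timer)]

lemma phase_reset_of_le (h : 2 * Real.pi ≤ x.phase) : x.reset.phase = 0 := if_pos h

lemma phase_reset_of_not_le (h : ¬ 2 * Real.pi ≤ x.phase) : x.reset.phase = x.phase := if_neg h

/-- A flow followed by the reset keeps the invariants: the threshold cannot be reached during an
adjustment with a negative phase rate. -/
lemma Valid.reset_flow (h : x.Valid ω₀ ωmax) (hω₀ : 0 < ω₀) {s : ℝ} (hs : 0 ≤ s) :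
    (x.flow ω₀ s).reset.Valid ω₀ ωmax := by
  have h0 := h.timer_nonneg
  have hmt : min s x.timer ≤ x.timer := min_le_right _ _
  have hms : min s x.timer ≤ s := min_le_left _ _
  have hm0 : 0 ≤ min s x.timer := le_min hs h0
  have hω : 0 ≤ ω₀ * (s - min s x.timer) := mul_nonneg hω₀.le (by linarith)
  have hend : 0 ≤ x.freq ∨
      0 ≤ x.phase + x.freq * min s x.timer + x.freq * (x.timer - min s x.timer) :=
    h.end_nonneg.imp_right fun h => by nlinarith
  have hrate : x.timer - min s x.timer = 0 ∨ x.freq - ω₀ = ωmax ∨ x.freq - ω₀ = -ωmax := by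
    rcases h.rate with h | h
    · left; simp [h, hs]
    · exact Or.inr h
  by_cases hc : 2 * Real.pi ≤ (x.flow ω₀ s).phase
  · have e : (x.flow ω₀ s).reset.phase = 0 := phase_reset_of_le hc
    refine ⟨e.ge, by rw [e]; positivity, sub_nonneg.2 hmt, hrate, ?_⟩
    rw [e]
    change 0 ≤ x.freq ∨ 0 ≤ 0 + x.freq * (x.timer - min s x.timer)
    refine (le_or_gt 0 x.freq).imp_right fun h1 => ?_
    rcases le_total s x.timer with hst | hst
    · change 2 * Real.pi ≤ x.phase + x.freq * min s x.timer + ω₀ * (s - min s x.timer) at hc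
      rw [min_eq_left hst] at hc
      nlinarith [h.phase_lt]
    · simp [hst]
  · have e : (x.flow ω₀ s).reset.phase =
        x.phase + x.freq * min s x.timer + ω₀ * (s - min s x.timer) :=
      phase_reset_of_not_le hc
    refine ⟨?_, by rw [e]; exact not_le.1 hc, sub_nonneg.2 hmt, hrate, ?_⟩
    · rw [e]
      have hφ := h.phase_nonneg
      rcases le_total 0 x.freq with h2 | h2
      · positivity
      · rcases h.end_nonneg with h1 | h1
        · have := mul_nonneg h1 hm0
          linarith
        · nlinarith
    · rw [e]
      change 0 ≤ x.freq ∨ 0 ≤ x.phase + x.freq * min s x.timer + ω₀ * (s - min s x.timer) +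
        x.freq * (x.timer - min s x.timer)
      exact hend.imp_right fun h => by linarith

lemma heading_respond (α D : ℝ) : (x.respond ω₀ ωmax α D).heading = x.heading := by
  simp only [respond]; split_ifs <;> rfl

lemma phase_respond (α D : ℝ) : (x.respond ω₀ ωmax α D).phase = x.phase := by
  simp only [respond]; split_ifs <;> rfl

lemma target_respond {α D : ℝ} (hωmax : 0 < ωmax) (hD : D ≤ x.phase) :
    (x.respond ω₀ ωmax α D).target ω₀ = x.heading + α * delayAdvance x.phase := by
  simp only [respond, not_lt.2 hD, if_false, target, add_sub_cancel_left]
  rw [mul_assoc, mul_div_cancel₀ _ hωmax.ne', sign_mul_abs]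

lemma Valid.respond {α D : ℝ} (h : x.Valid ω₀ ωmax) (hω₀ : 0 < ω₀) (hωmax : 0 < ωmax)
    (hα : α ∈ Set.Ioc (0 : ℝ) 1) : (x.respond ω₀ ωmax α D).Valid ω₀ ωmax := by
  simp only [RobotState.respond]
  split_ifs with hD
  · exact h
  refine ⟨h.phase_nonneg, h.phase_lt, by positivity, ?_, ?_⟩
  · rcases lt_trichotomy (α * delayAdvance x.phase) 0 with h1 | h1 | h1
    · right; right; simp [sign_neg h1]
    · left; simp [h1]
    · right; left; simp [sign_pos h1]
  · rcases lt_or_ge (α * delayAdvance x.phase) 0 with h1 | h1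
    · right
      have hQ : delayAdvance x.phase < 0 := by
        by_contra! hQ
        exact absurd (mul_nonneg hα.1.le hQ) (not_le.2 h1)
      have hQ' : delayAdvance x.phase = -x.phase := by
        unfold delayAdvance at hQ ⊢
        split_ifs at hQ ⊢
        · rfl
        · linarith [h.phase_lt]
      rw [hQ'] at h1
      simp only [hQ', sign_neg h1, abs_of_neg h1, SignType.coe_neg_one]
      have h2 : 0 ≤ -(α * -x.phase) / ωmax := by
        have := mul_nonneg hα.1.le h.phase_nonneg
        apply div_nonneg _ hωmax.le
        linarith
      have h3 : ωmax * (-(α * -x.phase) / ωmax) = α * x.phase := by field_simp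
      have h4 := mul_nonneg (sub_nonneg.2 hα.2) h.phase_nonneg
      have h5 := mul_nonneg hω₀.le h2
      nlinarith
    · left
      rcases h1.eq_or_lt with h1 | h1
      · simp [← h1, hω₀.le]
      · simp [sign_pos h1]; positivity

end RobotState

/-- At a pulse, the phase response curve is the signed distance to the heading of the sender. -/
lemma delayAdvance_eq {φ d : ℝ} {q : ℤ} (h0 : 0 ≤ φ) (h1 : φ < 2 * Real.pi) (hd : |d| < Real.pi)
    (hφ : φ = 2 * Real.pi * q - d) :
    delayAdvance φ = d ∧ (0 < d → φ = 2 * Real.pi - d) := by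
  have hπ := Real.pi_pos
  obtain ⟨hd1, hd2⟩ := abs_lt.1 hd
  have hq : q = 0 ∨ q = 1 := by
    have h2 : (-1 : ℝ) < q := by nlinarith
    have h3 : (q : ℝ) < 2 := by nlinarith
    have h4 : -1 < q := by exact_mod_cast h2
    have h5 : q < 2 := by exact_mod_cast h3
    omega
  unfold delayAdvance
  rcases hq with rfl | rfl
  · push_cast at hφ
    refine ⟨?_, fun h => by linarith⟩
    rw [if_pos (by linarith)]; linarith
  · push_cast at hφ
    refine ⟨?_, fun h => by linarith⟩
    rw [if_neg (by linarith)]; linarith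

/-! ### The waiting time -/

section waitingTime

variable {N : ℕ} {ω₀ ωmax : ℝ} {x : Fin N → RobotState}

lemma waitingTime_mem (hω₀ : 0 < ω₀) (hN : 1 ≤ N) (hx : ∀ i, (x i).Valid ω₀ ωmax) :
    0 ≤ waitingTime ω₀ x ∧ ∃ i, 2 * Real.pi ≤ ((x i).flow ω₀ (waitingTime ω₀ x)).phase := by
  have hclosed : IsClosed {s : ℝ | 0 ≤ s ∧ ∃ i, 2 * Real.pi ≤ ((x i).flow ω₀ s).phase} := by
    simp only [Set.ofPred_and, Set.ofPred_exists]
    exact isClosed_Ici.inter (isClosed_iUnion_of_finite fun i =>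
      isClosed_le continuous_const RobotState.continuous_phase_flow)
  obtain ⟨s, hs, h⟩ := (hx ⟨0, hN⟩).exists_two_pi_le_phase_flow hω₀
  exact hclosed.csInf_mem ⟨s, hs, _, h⟩ ⟨0, fun s hs => hs.1⟩

lemma waitingTime_pos (hω₀ : 0 < ω₀) (hN : 1 ≤ N) (hx : ∀ i, (x i).Valid ω₀ ωmax) :
    0 < waitingTime ω₀ x := by
  obtain ⟨h0, i, hi⟩ := waitingTime_mem hω₀ hN hx
  refine h0.lt_of_ne fun h => ?_
  rw [← h, RobotState.phase_flow_zero (hx i)] at hi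
  exact absurd (hx i).phase_lt (not_lt.2 hi)

lemma phase_flow_waitingTime_le (hω₀ : 0 < ω₀) (hN : 1 ≤ N) (hx : ∀ i, (x i).Valid ω₀ ωmax)
    (i : Fin N) : ((x i).flow ω₀ (waitingTime ω₀ x)).phase ≤ 2 * Real.pi := by
  by_contra! h
  have hpos := waitingTime_pos hω₀ hN hx
  have hev : ∀ᶠ s in 𝓝 (waitingTime ω₀ x), 2 * Real.pi < ((x i).flow ω₀ s).phase :=
    (RobotState.continuous_phase_flow.tendsto _).eventually_const_lt h
  obtain ⟨s, hs, hs0, hsw⟩ := ((hev.filter_mono nhdsWithin_le_nhds).and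
    (Ioo_mem_nhdsLT hpos)).exists
  exact absurd (csInf_le ⟨0, fun s hs => hs.1⟩ ⟨hs0.le, i, hs.le⟩ : waitingTime ω₀ x ≤ s)
    (not_le.2 hsw)

end waitingTime

/-! ### One firing instance -/

section step

variable {N : ℕ} (G : Digraph (Fin N)) (ω₀ ωmax α D : ℝ) (x : Fin N → RobotState)

/-- Robot `i` fires at the next firing instance. -/
def Fires (i : Fin N) : Prop := 2 * Real.pi ≤ ((x i).flow ω₀ (waitingTime ω₀ x)).phase

/-- The state just after the next firing instance. -/
noncomputable def step : Fin N → RobotState :=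
  firing G ω₀ ωmax α D fun i => (x i).flow ω₀ (waitingTime ω₀ x)

variable {G ω₀ ωmax α D x}

lemma step_eq (i : Fin N) :
    step G ω₀ ωmax α D x i = ((x i).flow ω₀ (waitingTime ω₀ x)).reset ∧
        ¬ (∃ j, j ≠ i ∧ G.Adj j i ∧ Fires ω₀ x j) ∨
      step G ω₀ ωmax α D x i =
          ((x i).flow ω₀ (waitingTime ω₀ x)).reset.respond ω₀ ωmax α D ∧
        ∃ j, j ≠ i ∧ G.Adj j i ∧ Fires ω₀ x j := by
  by_cases h : ∃ j, j ≠ i ∧ G.Adj j i ∧ Fires ω₀ x j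
  · exact Or.inr ⟨if_pos h, h⟩
  · exact Or.inl ⟨if_neg h, h⟩

lemma heading_step (i : Fin N) :
    (step G ω₀ ωmax α D x i).heading = ((x i).flow ω₀ (waitingTime ω₀ x)).heading := by
  rcases step_eq (G := G) (ωmax := ωmax) (α := α) (D := D) i with ⟨h, -⟩ | ⟨h, -⟩ <;> rw [h]
  · rfl
  · rw [RobotState.heading_respond]; rfl

lemma phase_step (i : Fin N) :
    (step G ω₀ ωmax α D x i).phase = ((x i).flow ω₀ (waitingTime ω₀ x)).reset.phase := by
  rcases step_eq (G := G) (ωmax := ωmax) (α := α) (D := D) i with ⟨h, -⟩ | ⟨h, -⟩ <;> rw [h]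
  rw [RobotState.phase_respond]

lemma target_step_eq (hωmax : 0 < ωmax) {i j : Fin N} (hji : j ≠ i) (hadj : G.Adj j i)
    (hj : Fires ω₀ x j) (hD : D ≤ (step G ω₀ ωmax α D x i).phase) :
    (step G ω₀ ωmax α D x i).target ω₀ = (step G ω₀ ωmax α D x i).heading +
      α * delayAdvance (step G ω₀ ωmax α D x i).phase := by
  rcases step_eq (G := G) (ωmax := ωmax) (α := α) (D := D) i with ⟨-, h⟩ | ⟨h, -⟩
  · exact absurd ⟨j, hji, hadj, hj⟩ h
  · rw [h] at hD ⊢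
    rw [RobotState.phase_respond] at hD ⊢
    rw [RobotState.target_respond hωmax hD, RobotState.heading_respond]

lemma target_step_cases (hωmax : 0 < ωmax) (i : Fin N) :
    (step G ω₀ ωmax α D x i).target ω₀ = (x i).target ω₀ ∨ ∃ j, Fires ω₀ x j ∧
      (step G ω₀ ωmax α D x i).target ω₀ = (step G ω₀ ωmax α D x i).heading +
        α * delayAdvance (step G ω₀ ωmax α D x i).phase := by
  have hreset : ((x i).flow ω₀ (waitingTime ω₀ x)).reset.target ω₀ = (x i).target ω₀ :=
    RobotState.target_flow (waitingTime ω₀ x)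
  rcases step_eq (G := G) (ωmax := ωmax) (α := α) (D := D) i with ⟨h, -⟩ | ⟨h, j, hji, hadj, hj⟩
  · left; rw [h, hreset]
  · rcases lt_or_ge (step G ω₀ ωmax α D x i).phase D with hD | hD
    · left
      rw [phase_step] at hD
      rw [h, RobotState.respond, if_pos hD, hreset]
    · exact Or.inr ⟨j, hj, target_step_eq hωmax hji hadj hj hD⟩

lemma step_valid (hω₀ : 0 < ω₀) (hωmax : 0 < ωmax) (hα : α ∈ Set.Ioc (0 : ℝ) 1) (hN : 1 ≤ N)
    (hx : ∀ i, (x i).Valid ω₀ ωmax) (i : Fin N) : (step G ω₀ ωmax α D x i).Valid ω₀ ωmax := by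
  have hr := (hx i).reset_flow hω₀ (waitingTime_pos hω₀ hN hx).le
  rcases step_eq (G := G) (ωmax := ωmax) (α := α) (D := D) i with ⟨h, -⟩ | ⟨h, -⟩ <;> rw [h]
  · exact hr
  · exact hr.respond hω₀ hωmax hα

end step

/-! ### The run of the network -/

section run

variable {N : ℕ} (G : Digraph (Fin N)) (ω₀ ωmax α D : ℝ) (θ₀ : Fin N → ℝ)

open Classical in
/-- The cycle number: it starts at `c i` and counts the firings of robot `i`. -/
noncomputable def cycle (c : Fin N → ℤ) : ℕ → Fin N → ℤ
  | 0, i => c i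
  | n + 1, i => cycle c n i + if Fires ω₀ (eventState G ω₀ ωmax α D θ₀ n) i then 1 else 0

variable {G ω₀ ωmax α D θ₀}

lemma eventState_succ (n : ℕ) : eventState G ω₀ ωmax α D θ₀ (n + 1) =
    step G ω₀ ωmax α D (eventState G ω₀ ωmax α D θ₀ n) := rfl

lemma eventTime_succ (n : ℕ) : eventTime G ω₀ ωmax α D θ₀ (n + 1) =
    eventTime G ω₀ ωmax α D θ₀ n + waitingTime ω₀ (eventState G ω₀ ωmax α D θ₀ n) :=
  Finset.sum_range_succ _ _

lemma eventState_valid (hω₀ : 0 < ω₀) (hωmax : 0 < ωmax) (hα : α ∈ Set.Ioc (0 : ℝ) 1) (hN : 1 ≤ N)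
    (hθ₀ : ∀ i, θ₀ i ∈ Set.Ico (0 : ℝ) (2 * Real.pi)) (n : ℕ) :
    ∀ i, (eventState G ω₀ ωmax α D θ₀ n i).Valid ω₀ ωmax := by
  induction n with
  | zero => exact fun i => ⟨(hθ₀ i).1, (hθ₀ i).2, le_rfl, Or.inl rfl, Or.inl hω₀.le⟩
  | succ n ih => exact step_valid hω₀ hωmax hα hN ih

/-- The phase is the heading, lifted by `2π c i`, plus `ω₀ t`, less `2π` for each cycle. -/
lemma phase_eventState (hω₀ : 0 < ω₀) (hN : 1 ≤ N) (c : Fin N → ℤ)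
    (hv : ∀ n i, (eventState G ω₀ ωmax α D θ₀ n i).Valid ω₀ ωmax) (n : ℕ) (i : Fin N) :
    (eventState G ω₀ ωmax α D θ₀ n i).phase =
      (eventState G ω₀ ωmax α D θ₀ n i).heading + 2 * Real.pi * c i +
        ω₀ * eventTime G ω₀ ωmax α D θ₀ n -
        2 * Real.pi * cycle G ω₀ ωmax α D θ₀ c n i := by
  induction n with
  | zero => simp [eventState, initialState, eventTime, cycle]
  | succ n ih =>
    have h1 := RobotState.phase_flow (ω₀ := ω₀) (x := eventState G ω₀ ωmax α D θ₀ n i)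
      (waitingTime ω₀ (eventState G ω₀ ωmax α D θ₀ n))
    have h2 := phase_flow_waitingTime_le hω₀ hN (hv n) i
    rw [eventState_succ, phase_step, heading_step, eventTime_succ, cycle]
    by_cases hf : Fires ω₀ (eventState G ω₀ ωmax α D θ₀ n) i
    · have h3 : _ = 2 * Real.pi := le_antisymm h2 hf
      rw [if_pos hf, RobotState.phase_reset_of_le hf]
      push_cast
      linarith
    · rw [if_neg hf, RobotState.phase_reset_of_not_le hf]
      push_cast
      linarith

lemma phase_eventState_of_fires {n : ℕ} {i : Fin N}
    (h : Fires ω₀ (eventState G ω₀ ωmax α D θ₀ n) i) :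
    (eventState G ω₀ ωmax α D θ₀ (n + 1) i).phase = 0 := by
  rw [eventState_succ, phase_step]
  exact RobotState.phase_reset_of_le h

/-- When `j` fires, the phase response of a robot `i` is its signed distance to the heading of `j`;
its phase is outside the refractory region if it lags behind `j`. -/
lemma delayAdvance_of_fires (hω₀ : 0 < ω₀) (hN : 1 ≤ N) (c : Fin N → ℤ)
    (hv : ∀ n i, (eventState G ω₀ ωmax α D θ₀ n i).Valid ω₀ ωmax) {n : ℕ} {i j : Fin N}
    (h : Fires ω₀ (eventState G ω₀ ωmax α D θ₀ n) j) {d : ℝ} (hd : |d| < Real.pi)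
    (hdef : d = ((eventState G ω₀ ωmax α D θ₀ (n + 1) j).heading + 2 * Real.pi * c j) -
      ((eventState G ω₀ ωmax α D θ₀ (n + 1) i).heading + 2 * Real.pi * c i)) :
    delayAdvance (eventState G ω₀ ωmax α D θ₀ (n + 1) i).phase = d ∧
      (0 < d → (eventState G ω₀ ωmax α D θ₀ (n + 1) i).phase = 2 * Real.pi - d) := by
  have h1 := phase_eventState hω₀ hN c hv (n + 1) i
  have h2 := phase_eventState hω₀ hN c hv (n + 1) j
  rw [phase_eventState_of_fires h] at h2
  refine delayAdvance_eq (q := cycle G ω₀ ωmax α D θ₀ c (n + 1) j -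
    cycle G ω₀ ωmax α D θ₀ c (n + 1) i) (hv _ i).phase_nonneg (hv _ i).phase_lt hd ?_
  push_cast
  linarith

/-- An interval shorter than `π` that contains the lifted initial headings contains all later
lifted headings and targets. -/
lemma eventState_mem_Icc (hω₀ : 0 < ω₀) (hωmax : 0 < ωmax) (hα : α ∈ Set.Ioc (0 : ℝ) 1)
    (hN : 1 ≤ N) {c : Fin N → ℤ}
    (hv : ∀ n i, (eventState G ω₀ ωmax α D θ₀ n i).Valid ω₀ ωmax) {A l : ℝ} (hl : l < Real.pi)
    (h₀ : ∀ i, θ₀ i + 2 * Real.pi * c i ∈ Set.Icc A (A + l)) (n : ℕ) :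
    ∀ i, (eventState G ω₀ ωmax α D θ₀ n i).heading + 2 * Real.pi * c i ∈ Set.Icc A (A + l) ∧
      (eventState G ω₀ ωmax α D θ₀ n i).target ω₀ + 2 * Real.pi * c i ∈ Set.Icc A (A + l) := by
  induction n with
  | zero => simpa [eventState, initialState, RobotState.target] using h₀
  | succ n ih =>
    have hW := (waitingTime_pos hω₀ hN (hv n)).le
    have hωW := mul_nonneg hωmax.le hW
    have hx : ∀ i, (eventState G ω₀ ωmax α D θ₀ (n + 1) i).heading + 2 * Real.pi * c i ∈
        Set.Icc A (A + l) := by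
      intro i
      have h1 := (hv n i).min_le_heading_flow hωmax hW
      have h2 := (hv n i).heading_flow_le_max hωmax hW
      obtain ⟨⟨h3, h4⟩, h5, h6⟩ := ih i
      rw [eventState_succ, heading_step]
      constructor
      · rcases min_le_iff.1 h1 with h | h <;> linarith
      · rcases le_max_iff.1 h2 with h | h <;> linarith
    refine fun i => ⟨hx i, ?_⟩
    rcases target_step_cases (G := G) (α := α) (D := D) (x := eventState G ω₀ ωmax α D θ₀ n)
      (ω₀ := ω₀) hωmax i with h | ⟨j, hj, h⟩
    · rw [eventState_succ, h]; exact (ih i).2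
    · obtain ⟨h3, h4⟩ := hx i
      obtain ⟨h5, h6⟩ := hx j
      rw [← eventState_succ] at h
      rw [h, (delayAdvance_of_fires hω₀ hN c hv hj (abs_lt.2 ⟨by linarith, by linarith⟩) rfl).1]
      constructor <;> nlinarith [hα.1, hα.2]

/-- The firing instances of the network form a `PulseRun`, in which the heading of robot `i` is lifted
by `2π c i`, where the `c i` bring the initial headings into an interval shorter than `Λbar`. -/
lemma exists_pulseRun (hN : 1 ≤ N) (hω₀ : 0 < ω₀) (hωmax : 0 < ωmax)
    (hα : α ∈ Set.Ioc (0 : ℝ) 1) {Λbar : ℝ} (hΛbar : Λbar ∈ Set.Ioc (0 : ℝ) Real.pi)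
    (hD' : D ≤ 2 * Real.pi - Λbar) (hθ₀ : ∀ i, θ₀ i ∈ Set.Ico (0 : ℝ) (2 * Real.pi))
    (harc : containingArc (fun i => (θ₀ i : Real.Angle)) < Λbar) :
    ∃ (R : PulseRun G ω₀ ωmax α) (c : Fin N → ℤ), R.T = eventTime G ω₀ ωmax α D θ₀ ∧
      ∀ n i, R.x n i = (eventState G ω₀ ωmax α D θ₀ n i).heading + 2 * Real.pi * c i ∧
        R.g n i = (eventState G ω₀ ωmax α D θ₀ n i).target ω₀ + 2 * Real.pi * c i := by
  -- the infimum defining the containing arc is not the junk value of an empty set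
  have hne : {l : ℝ | 0 ≤ l ∧ ∃ a : ℝ, ∀ i, ∃ x ∈ Set.Icc a (a + l),
      (x : Real.Angle) = θ₀ i}.Nonempty :=
    ⟨2 * Real.pi, by positivity, 0, fun i => ⟨θ₀ i, ⟨(hθ₀ i).1, by linarith [(hθ₀ i).2]⟩, rfl⟩⟩
  obtain ⟨l, ⟨-, A, hA⟩, hl⟩ := exists_lt_of_csInf_lt hne harc
  have hlift : ∀ i, ∃ c : ℤ, θ₀ i + 2 * Real.pi * c ∈ Set.Icc A (A + l) := by
    intro i
    obtain ⟨y, hy, hyi⟩ := hA i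
    obtain ⟨c, hc⟩ := Real.Angle.angle_eq_iff_two_pi_dvd_sub.1 hyi
    refine ⟨c, ?_⟩
    rwa [← hc, add_sub_cancel]
  choose c hc using hlift
  have hv := eventState_valid (G := G) (D := D) hω₀ hωmax hα hN hθ₀
  have hmem := eventState_mem_Icc hω₀ hωmax hα hN hv (hl.trans_le hΛbar.2) hc
  have hphase := phase_eventState hω₀ hN c hv
  have hd : ∀ n i j, |((eventState G ω₀ ωmax α D θ₀ n j).heading + 2 * Real.pi * c j) -
      ((eventState G ω₀ ωmax α D θ₀ n i).heading + 2 * Real.pi * c i)| < Λbar := fun n i j =>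
    abs_lt.2 ⟨by linarith [(hmem n j).1.1, (hmem n i).1.2],
      by linarith [(hmem n j).1.2, (hmem n i).1.1]⟩
  have hfires : ∀ n i, cycle G ω₀ ωmax α D θ₀ c (n + 1) i = cycle G ω₀ ωmax α D θ₀ c n i + 1 ↔
      Fires ω₀ (eventState G ω₀ ωmax α D θ₀ n) i := by
    intro n i
    rw [cycle]
    split_ifs with h <;> simp [h]
  refine ⟨{
    T := eventTime G ω₀ ωmax α D θ₀
    x := fun n i => (eventState G ω₀ ωmax α D θ₀ n i).heading + 2 * Real.pi * c i
    g := fun n i => (eventState G ω₀ ωmax α D θ₀ n i).target ω₀ + 2 * Real.pi * c i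
    k := cycle G ω₀ ωmax α D θ₀ c
    T_lt := fun n => by
      rw [eventTime_succ]
      linarith [waitingTime_pos hω₀ hN (hv n)]
    spread := ⟨A, l, hl.trans_le hΛbar.2, hmem⟩
    move_lower := fun n i => by
      rw [eventTime_succ, add_sub_cancel_left, eventState_succ, heading_step, add_right_comm,
        min_add_add_right]
      have := (hv n i).min_le_heading_flow hωmax (waitingTime_pos hω₀ hN (hv n)).le
      linarith
    move_upper := fun n i => by
      rw [eventTime_succ, add_sub_cancel_left, eventState_succ, heading_step, add_sub_right_comm,
        max_add_add_right]
      have := (hv n i).heading_flow_le_max hωmax (waitingTime_pos hω₀ hN (hv n)).le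
      linarith
    phase_nonneg := fun n i => by
      linarith [hphase n i, (hv n i).phase_nonneg]
    phase_lt := fun n i => by
      linarith [hphase n i, (hv n i).phase_lt]
    k_step := fun n i => by
      by_cases h : Fires ω₀ (eventState G ω₀ ωmax α D θ₀ n) i
      · refine Or.inr ⟨(hfires n i).2 h, ?_⟩
        have := hphase (n + 1) i
        rw [phase_eventState_of_fires h] at this
        linarith
      · left
        rw [cycle, if_neg h, add_zero]
    exists_fires := fun n => by
      obtain ⟨i, hi⟩ := (waitingTime_mem hω₀ hN (hv n)).2
      exact ⟨i, (hfires n i).2 hi⟩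
    target_step := fun n i => by
      rcases target_step_cases (G := G) (α := α) (D := D) (x := eventState G ω₀ ωmax α D θ₀ n)
        (ω₀ := ω₀) hωmax i with h | ⟨j, hj, h⟩
      · left; rw [eventState_succ, h]
      · refine Or.inr ⟨j, (hfires n j).2 hj, ?_⟩
        rw [← eventState_succ] at h
        rw [h, (delayAdvance_of_fires hω₀ hN c hv hj
          ((hd (n + 1) i j).trans_le hΛbar.2) rfl).1]
        ring
    target_of_lag := fun n i j hadj hj hlt => by
      rw [hfires] at hj
      have hji : j ≠ i := by
        rintro rfl
        exact lt_irrefl _ hlt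
      obtain ⟨h1, h2⟩ := delayAdvance_of_fires hω₀ hN c hv hj
          ((hd (n + 1) i j).trans_le hΛbar.2) rfl
      have h3 := h2 (sub_pos.2 hlt)
      have h4 := (abs_lt.1 (hd (n + 1) i j)).2
      have h := target_step_eq (α := α) hωmax hji hadj hj
        (by rw [← eventState_succ, h3]; linarith)
      rw [← eventState_succ, h1] at h
      rw [h]
      ring }, c, rfl, fun n i => ⟨rfl, rfl⟩⟩

end run

/-! ### Continuous time -/

section time

variable {N : ℕ} {G : Digraph (Fin N)} {ω₀ ωmax α D : ℝ} {θ₀ : Fin N → ℝ}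

/-- The last firing instance up to time `t`. -/
lemma eventCount_spec (hlt : ∀ n, eventTime G ω₀ ωmax α D θ₀ n < eventTime G ω₀ ωmax α D θ₀ (n + 1))
    (htop : Tendsto (eventTime G ω₀ ωmax α D θ₀) atTop atTop) {t : ℝ} (ht : 0 ≤ t) :
    eventTime G ω₀ ωmax α D θ₀ (eventCount G ω₀ ωmax α D θ₀ t) ≤ t ∧
      t < eventTime G ω₀ ωmax α D θ₀ (eventCount G ω₀ ωmax α D θ₀ t + 1) ∧
      ∀ n, eventTime G ω₀ ωmax α D θ₀ n ≤ t → n ≤ eventCount G ω₀ ωmax α D θ₀ t := by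
  have hmono := strictMono_nat_of_lt_succ hlt
  have hbdd : BddAbove {n : ℕ | eventTime G ω₀ ωmax α D θ₀ n ≤ t} := by
    obtain ⟨B, hB⟩ := (htop.eventually_gt_atTop t).exists
    exact ⟨B, fun n hn => (hmono.lt_iff_lt.1 (lt_of_le_of_lt hn hB)).le⟩
  have hne : {n : ℕ | eventTime G ω₀ ωmax α D θ₀ n ≤ t}.Nonempty := ⟨0, by simpa [eventTime] using ht⟩
  refine ⟨Nat.sSup_mem hne hbdd, ?_, fun n hn => le_csSup hbdd hn⟩
  by_contra! h
  exact absurd (le_csSup hbdd h) (Nat.not_succ_le_self _)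

/-- The rate constraint holds across firing instances, because these leave the headings unchanged. -/
lemma abs_heading_sub_le (hωmax : 0 < ωmax)
    (hv : ∀ n i, (eventState G ω₀ ωmax α D θ₀ n i).Valid ω₀ ωmax)
    (hlt : ∀ n, eventTime G ω₀ ωmax α D θ₀ n < eventTime G ω₀ ωmax α D θ₀ (n + 1))
    (htop : Tendsto (eventTime G ω₀ ωmax α D θ₀) atTop atTop) (i : Fin N) {s t : ℝ} (hs : 0 ≤ s)
    (hst : s ≤ t) :
    |heading G ω₀ ωmax α D θ₀ i t - heading G ω₀ ωmax α D θ₀ i s| ≤ ωmax * (t - s) := by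
  obtain ⟨hs1, hs2, -⟩ := eventCount_spec hlt htop hs
  obtain ⟨ht1, ht2, ht3⟩ := eventCount_spec hlt htop (hs.trans hst)
  have hle := ht3 _ (hs1.trans hst)
  simp only [heading, stateAt]
  generalize eventCount G ω₀ ωmax α D θ₀ s = p at *
  generalize eventCount G ω₀ ωmax α D θ₀ t = r at *
  rcases hle.eq_or_lt with rfl | hpr
  · refine ((hv p i).abs_heading_flow_sub_le hωmax (by linarith) (by linarith)).trans_eq ?_
    rw [sub_sub_sub_cancel_right, abs_of_nonneg (by linarith)]
  have hnext : ∀ n u, 0 ≤ u → u ≤ eventTime G ω₀ ωmax α D θ₀ (n + 1) - eventTime G ω₀ ωmax α D θ₀ n →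
      |(eventState G ω₀ ωmax α D θ₀ (n + 1) i).heading -
        ((eventState G ω₀ ωmax α D θ₀ n i).flow ω₀ u).heading| ≤
        ωmax * (eventTime G ω₀ ωmax α D θ₀ (n + 1) - eventTime G ω₀ ωmax α D θ₀ n - u) := by
    intro n u hu hun
    rw [eventTime_succ, add_sub_cancel_left] at hun ⊢
    rw [eventState_succ, heading_step]
    refine ((hv n i).abs_heading_flow_sub_le hωmax hu (hu.trans hun)).trans_eq ?_
    rw [abs_of_nonneg (by linarith)]
  have hevents : ∀ n, p + 1 ≤ n → |(eventState G ω₀ ωmax α D θ₀ n i).heading -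
      (eventState G ω₀ ωmax α D θ₀ (p + 1) i).heading| ≤
      ωmax * (eventTime G ω₀ ωmax α D θ₀ n - eventTime G ω₀ ωmax α D θ₀ (p + 1)) := by
    intro n hn
    induction n, hn using Nat.le_induction with
    | base => simp
    | succ n hn ih =>
      have h1 := hnext n 0 le_rfl (by linarith [hlt n])
      rw [RobotState.heading_flow_zero (hv n i)] at h1
      refine (abs_sub_le _ (eventState G ω₀ ωmax α D θ₀ n i).heading _).trans ?_
      linarith
  have h1 := hnext p (s - eventTime G ω₀ ωmax α D θ₀ p) (by linarith) (by linarith)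
  have h2 := hevents r hpr
  have h3 := (hv r i).abs_heading_flow_sub_le hωmax le_rfl (sub_nonneg.2 ht1)
  rw [RobotState.heading_flow_zero (hv r i), sub_zero, abs_of_nonneg (sub_nonneg.2 ht1)] at h3
  have h4 := abs_sub_le ((eventState G ω₀ ωmax α D θ₀ r i).flow ω₀
    (t - eventTime G ω₀ ωmax α D θ₀ r)).heading (eventState G ω₀ ωmax α D θ₀ r i).heading
    ((eventState G ω₀ ωmax α D θ₀ p i).flow ω₀ (s - eventTime G ω₀ ωmax α D θ₀ p)).heading
  have h5 := abs_sub_le (eventState G ω₀ ωmax α D θ₀ r i).heading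
    (eventState G ω₀ ωmax α D θ₀ (p + 1) i).heading
    ((eventState G ω₀ ωmax α D θ₀ p i).flow ω₀ (s - eventTime G ω₀ ωmax α D θ₀ p)).heading
  linarith

/-- Real lifts of the headings that are eventually confined to arbitrarily short intervals give a
vanishing containing arc and a common limit. -/
lemma synchronization_of_lift {h : Fin N → ℝ → ℝ} (hN : 1 ≤ N) (c : Fin N → ℤ)
    (H : ∀ ε > 0, ∃ m M t₀ : ℝ, M - m ≤ ε ∧
      ∀ t ≥ t₀, ∀ i, h i t + 2 * Real.pi * c i ∈ Set.Icc m M) :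
    Tendsto (fun t => containingArc fun i => (h i t : Real.Angle)) atTop (𝓝 0) ∧
    ∃ θlim : Real.Angle, ∀ i, Tendsto (fun t => (h i t : Real.Angle)) atTop (𝓝 θlim) := by
  have hcoe : ∀ i t, ((h i t + 2 * Real.pi * c i : ℝ) : Real.Angle) = h i t := fun i t =>
    Real.Angle.angle_eq_iff_two_pi_dvd_sub.2 ⟨c i, by ring⟩
  constructor
  · rw [Metric.tendsto_atTop]
    intro ε hε
    obtain ⟨m, M, t₀, hmM, ht₀⟩ := H (ε / 2) (half_pos hε)
    refine ⟨t₀, fun t ht => ?_⟩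
    have hle : m ≤ M := (ht₀ t ht ⟨0, hN⟩).1.trans (ht₀ t ht ⟨0, hN⟩).2
    have h0 : 0 ≤ containingArc fun i => (h i t : Real.Angle) :=
      Real.sInf_nonneg fun l hl => hl.1
    have h1 : (containingArc fun i => (h i t : Real.Angle)) ≤ M - m :=
      csInf_le ⟨0, fun l hl => hl.1⟩ ⟨sub_nonneg.2 hle, m, fun i =>
        ⟨_, by rw [add_sub_cancel]; exact ht₀ t ht i, hcoe i t⟩⟩
    rw [Real.dist_0_eq_abs, abs_of_nonneg h0]
    linarith
  · have hdist : ∀ ε > 0, ∃ t₀ : ℝ, ∀ s ≥ t₀, ∀ t ≥ t₀, ∀ i j,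
        dist (h i s + 2 * Real.pi * c i) (h j t + 2 * Real.pi * c j) < ε := by
      intro ε hε
      obtain ⟨m, M, t₀, hmM, ht₀⟩ := H (ε / 2) (half_pos hε)
      refine ⟨t₀, fun s hs t ht i j => ?_⟩
      obtain ⟨h1, h2⟩ := ht₀ s hs i
      obtain ⟨h3, h4⟩ := ht₀ t ht j
      rw [Real.dist_eq, abs_lt]
      constructor <;> linarith
    have hcauchy : CauchySeq fun t => h ⟨0, hN⟩ t + 2 * Real.pi * c ⟨0, hN⟩ :=
      Metric.cauchySeq_iff.2 fun ε hε => by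
        obtain ⟨t₀, ht₀⟩ := hdist ε hε
        exact ⟨t₀, fun s hs t ht => ht₀ s hs t ht _ _⟩
    obtain ⟨L, hL⟩ := cauchySeq_tendsto_of_complete hcauchy
    refine ⟨L, fun i => ?_⟩
    have hi : Tendsto (fun t => h i t + 2 * Real.pi * c i) atTop (𝓝 L) := by
      refine (tendsto_iff_of_dist ?_).1 hL
      rw [Metric.tendsto_atTop]
      intro ε hε
      obtain ⟨t₀, ht₀⟩ := hdist ε hε
      refine ⟨t₀, fun t ht => ?_⟩
      rw [Real.dist_0_eq_abs, abs_of_nonneg dist_nonneg]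
      exact ht₀ t ht t ht _ _
    simpa only [hcoe, Function.comp_def] using
      (Real.Angle.continuous_coe.tendsto L).comp hi

end time

end HeadingSync

theorem mainTheorem2 {N : ℕ} (hN : 1 ≤ N) (G : Digraph (Fin N))
    (hG : HeadingSync.StronglyConnected G)
    (ω₀ ωmax : ℝ) (hω₀ : 0 < ω₀) (hωmax : 0 < ωmax)
    (α : ℝ) (hα : α ∈ Set.Ioc (0 : ℝ) 1)
    (Λbar : ℝ) (hΛbar : Λbar ∈ Set.Ioc (0 : ℝ) Real.pi)
    (D : ℝ) (hD : 0 ≤ D) (hD' : D ≤ 2 * Real.pi - Λbar)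
    (θ₀ : Fin N → ℝ) (hθ₀ : ∀ i, θ₀ i ∈ Set.Ico (0 : ℝ) (2 * Real.pi))
    (harc : HeadingSync.containingArc (fun i => (θ₀ i : Real.Angle)) < Λbar) :
    -- firing instances do not accumulate, so that the evolution is defined for all times
    Tendsto (HeadingSync.eventTime G ω₀ ωmax α D θ₀) atTop atTop ∧
    (∀ i, HeadingSync.heading G ω₀ ωmax α D θ₀ i 0 = θ₀ i) ∧
    -- the heading rate constraint
    (∀ i, ∀ s t : ℝ, 0 ≤ s → 0 ≤ t →
      |HeadingSync.heading G ω₀ ωmax α D θ₀ i t - HeadingSync.heading G ω₀ ωmax α D θ₀ i s|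
        ≤ ωmax * |t - s|) ∧
    -- synchronization
    Tendsto (fun t : ℝ => HeadingSync.containingArc
      (fun i => (HeadingSync.heading G ω₀ ωmax α D θ₀ i t : Real.Angle))) atTop (𝓝 0) ∧
    ∃ θlim : Real.Angle, ∀ i, Tendsto
      (fun t : ℝ => (HeadingSync.heading G ω₀ ωmax α D θ₀ i t : Real.Angle)) atTop (𝓝 θlim) := by
  open HeadingSync in
  have hv := eventState_valid (G := G) (D := D) hω₀ hωmax hα hN hθ₀
  obtain ⟨R, c, hT, hR⟩ := exists_pulseRun (G := G) hN hω₀ hωmax hα hΛbar hD' hθ₀ harc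
  have hlt := R.T_lt
  have htop := R.tendsto_T hω₀
  rw [hT] at hlt htop
  refine ⟨htop, fun i => ?_, fun i s t hs ht => ?_, ?_⟩
  · obtain ⟨h1, -, -⟩ := eventCount_spec hlt htop le_rfl
    have h2 : eventCount G ω₀ ωmax α D θ₀ 0 = 0 := by
      by_contra h
      have := strictMono_nat_of_lt_succ hlt (Nat.pos_of_ne_zero h)
      simp only [eventTime, Finset.range_zero, Finset.sum_empty] at this h1
      exact absurd h1 (not_le.2 this)
    rw [heading, stateAt, h2, eventTime, Finset.range_zero, Finset.sum_empty, sub_zero,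
      RobotState.heading_flow_zero (hv 0 i)]
    rfl
  · rcases le_total s t with hst | hst
    · rw [abs_of_nonneg (sub_nonneg.2 hst)]
      exact abs_heading_sub_le hωmax hv hlt htop i hs hst
    · rw [abs_sub_comm, abs_sub_comm t s, abs_of_nonneg (sub_nonneg.2 hst)]
      exact abs_heading_sub_le hωmax hv hlt htop i ht hst
  · refine synchronization_of_lift hN c fun ε hε => ?_
    obtain ⟨n, m, M, hm, hM, hmM⟩ := R.exists_bound hω₀ hωmax hα hG hε
    refine ⟨m, M, max 0 (eventTime G ω₀ ωmax α D θ₀ n), hmM, fun t ht i => ?_⟩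
    obtain ⟨h1, -, h2⟩ := eventCount_spec hlt htop (le_of_max_le_left ht)
    have h3 := h2 n (le_of_max_le_right ht)
    have hm' := hm.mono hωmax hα (Or.inl rfl) h3 i
    have hM' := hM.mono hωmax hα (Or.inr rfl) h3 i
    rw [(hR _ i).1, (hR _ i).2] at hm' hM'
    have h4 := (hv (eventCount G ω₀ ωmax α D θ₀ t) i).min_le_heading_flow hωmax (sub_nonneg.2 h1)
    have h5 := (hv (eventCount G ω₀ ωmax α D θ₀ t) i).heading_flow_le_max hωmax (sub_nonneg.2 h1)
    have h6 := mul_nonneg hωmax.le (sub_nonneg.2 h1)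
    rw [heading, stateAt]
    constructor
    · rcases min_le_iff.1 h4 with h | h <;> linarith
    · rcases le_max_iff.1 h5 with h | h <;> linarith
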